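/- Let $\beta>1$ be a Pisot number (a real algebraic integer $>1$, possibly a rational integer, all of whose other conjugates have modulus $<1$). Let $T_\beta(x)=\beta x-\lfloor\beta x\rfloor$, and let $d_\beta(x)=u_1u_2\cdots$ with $u_i=\lfloor\beta T_\beta^{i-1}(x)\rfloor$ be the $\beta$-expansion of $x\in[0,1]$. Assume property (F): $d_\beta(x)$ ends in zeros for every $x\in\mathbb Z[1/\beta]\cap[0,1)$. Notation. For real $y\ge 0$ let $\{y\}_\beta=T_\beta^p(y\beta^{-p})$, where $p\ge 0$ is the least integer with $y<\beta^p$, be its $\beta$-fractional part. Let $d^*_\beta(1)=t_1t_2\cdots$ be $(t_1\cdots t_N)^\infty$ if $d_\beta(1)=t_1\cdots t_{N-1}(t_N+1)0^\infty$, and $d_\beta(1)$ if $d_\beta(1)$ is infinite; write $d_\beta^*(1)=t_1\cdots t_m(t_{m+1}\cdots t_n)^\infty$ with minimal preperiod $m$ and minimal period $n-m$. A finite word $w$ is admissible if every shift of $w0^\infty$ is lexicographically smaller than $d^*_\beta(1)$. The admissibility graph has nodes $1,\dots,n$; from each node $b$ there are edges to $1$ labelled $0,\dots,t_b-1$ and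 one edge labelled $t_b$, leading to $b+1$ if $b<n$ and to $m+1$ if $b=n$. Let $\mathcal L^{(a)}_\beta$ be the set of admissible words that label a path from $1$ to $a$. Let $K_\infty$ be the product of the archimedean completions of $\mathbb Q(\beta)$ other than the one given by $\mathbb Q(\beta)\subset\mathbb R$, let $K_f=\prod_{\mathfrak P}K_{\mathfrak P}$ over the prime ideals $\mathfrak P\ni\beta$ of the ring of integers of $\mathbb Q(\beta)$, let $K_\beta=K_\infty\times K_f$ with the product topology and Haar measure $\mu_\beta$ of its additive group, and let $\phi_\beta:\mathbb Q(\beta)\to K_\beta$ be the diagonal embedding. Put $X=\mathbb Z[1/\beta]\cap[0,1)$. The complete $x$-tile ($x\in X$) and the complete central $a$-subtile ($1\le a\le n$) are $$\widetilde{\mathcal T}(x)=\overline{\phi_\beta(\{y\in\mathbb R_{\ge 0}:\{y\}_\beta=x\})},\qquad \widetilde{\mathcal T}^{(a)}=\overline{\phi_\beta(\{w_p\beta^p+\dots+w_0: w_p\cdots w_0\in\mathcal L_\beta^{(a)}\})}.$$ A point of a member of a family of sets is exclusive if it lies in no other member (members being distinguished by their indices). Theorem. 1. For every $x\in X$, $\widetilde{\mathcal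 T}(x)$ is the closure of its interior, all its inner points are exclusive in the family $(\widetilde{\mathcal T}(x'))_{x'\in X}$, and $\mu_\beta(\partial\widetilde{\mathcal T}(x))=0$. For $x\ne x'$ in $X$, $\widetilde{\mathcal T}(x')$ does not meet the interior of $\widetilde{\mathcal T}(x)$, and $\mu_\beta(\widetilde{\mathcal T}(x)\cap\widetilde{\mathcal T}(x'))=0$. 2. For every $a\in\{1,\dots,n\}$, all the assertions of part 1 hold for the family of translates $(\widetilde{\mathcal T}^{(a)}+\phi_\beta(x))_{x\in X}$ in place of $(\widetilde{\mathcal T}(x))_{x\in X}$. 3. In the family of all translates $\widetilde{\mathcal T}^{(a)}+\phi_\beta(x)$ with $1\le a\le n$, $x\in X$ and $x<T_\beta^{a-1}(1)$, indexed by the pairs $(a,x)$, all inner points of each member are exclusive; no member meets the interior of another one, and any two different members intersect in a set of $\mu_\beta$-measure zero. -/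

import Mathlib

open MeasureTheory IntermediateField IsDedekindDomain
open scoped NumberField

noncomputable section

namespace BetaTile

/-! ### Beta-numeration -/

/-- A Pisot number: a real algebraic integer `β > 1` all of whose other conjugates have
modulus less than one. (The integers `β ≥ 2` are included.) -/
structure IsPisot (β : ℝ) : Prop where
  one_lt : 1 < β
  isIntegral : IsIntegral ℤ β
  norm_conj_lt : ∀ z : ℂ, Polynomial.aeval z (minpoly ℚ β) = 0 → z ≠ (β : ℂ) → ‖z‖ < 1

/-- The `β`-transformation `T_β : x ↦ βx mod 1`. -/
def betaMap (β x : ℝ) : ℝ := Int.fract (β * x)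

/-- The digits of the `β`-expansion `d_β(x)` of `x ∈ [0,1]`; the first digit has index `0`. -/
def digit (β x : ℝ) (i : ℕ) : ℕ := ⌊β * (betaMap β)^[i] x⌋₊

/-- `d_β(x)` is finite, i.e. it ends in zeros. -/
def HasFiniteExpansion (β x : ℝ) : Prop := ∃ N, ∀ i ≥ N, digit β x i = 0

/-- The ring `ℤ[1/β]`, as a subring of `ℝ`. -/
def zInv (β : ℝ) : Subring ℝ := (Algebra.adjoin ℤ {β⁻¹}).toSubring

/-- The finiteness property (F). -/
def FinitenessProperty (β : ℝ) : Prop :=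
  ∀ x ∈ zInv β, 0 ≤ x → x < 1 → HasFiniteExpansion β x

/-- The fractional part `{y}_β` of a real number `y ≥ 0`: if `y < β ^ p` and
`d_β(y / β ^ p) = u₁u₂⋯`, the `β`-fractional part of `y` is the number `T_β^p (y / β ^ p)`,
which has the expansion `u_{p+1}u_{p+2}⋯`. -/
def betaFract (β y : ℝ) : ℝ :=
  let p := sInf {p : ℕ | y < β ^ p}
  (betaMap β)^[p] (y / β ^ p)

open Classical in
/-- The quasi-greedy expansion `d*_β(1)`. If `d_β(1) = t₁⋯t_{N-1}(t_N + 1)0^∞` is finite, it is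
`(t₁⋯t_N)^∞`, otherwise it is `d_β(1)`. The first digit has index `0`. -/
def dStar (β : ℝ) (i : ℕ) : ℕ :=
  if HasFiniteExpansion β 1 then
    let N := sInf {N | ∀ i ≥ N, digit β 1 i = 0}
    if i % N = N - 1 then digit β 1 (N - 1) - 1 else digit β 1 (i % N)
  else digit β 1 i

/-- The digits `t₁, t₂, …` of `d*_β(1)`, numbered from one. -/
def parryDigit (β : ℝ) (a : ℕ) : ℕ := dStar β (a - 1)

/-- The length `m` of the preperiod of `d*_β(1)`. -/
def preperiod (β : ℝ) : ℕ :=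
  sInf {m | ∃ p, 1 ≤ p ∧ ∀ i ≥ m, dStar β (i + p) = dStar β i}

/-- The length of the period of `d*_β(1)`. -/
def period (β : ℝ) : ℕ :=
  sInf {p | 1 ≤ p ∧ ∀ i ≥ preperiod β, dStar β (i + p) = dStar β i}

/-- The number `n` of nodes of the admissibility graph: `d*_β(1) = t₁⋯t_m(t_{m+1}⋯t_n)^∞`.
The set `𝒜` of nodes is `{1, …, n}`. -/
def nodeCount (β : ℝ) : ℕ := preperiod β + period β

/-- A finite string `w` of digits is admissible if `w0^∞` and all its shifts are
lexicographically less than `d*_β(1)`. -/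
def Admissible (β : ℝ) (w : List ℕ) : Prop :=
  ∀ k, toLex (fun i : ℕ => w.getD (k + i) 0) < toLex (dStar β)

/-- The edges `b --ε--> a` of the admissibility graph: from the node `b` there are edges to the
node `1` with the labels `0, …, t_b - 1`, and one edge labelled `t_b`, which goes to the
node `b + 1` if `b < n` and to the node `m + 1` if `b = n`. -/
def Edge (β : ℝ) (b ε a : ℕ) : Prop :=
  (ε < parryDigit β b ∧ a = 1) ∨
    (ε = parryDigit β b ∧ a = if b = nodeCount β then preperiod β + 1 else b + 1)

/-- `Reaches β w a`: the string `w`, read from left to right, labels a path of the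
admissibility graph from the node `1` to the node `a`. -/
inductive Reaches (β : ℝ) : List ℕ → ℕ → Prop
  | nil : Reaches β [] 1
  | snoc {w : List ℕ} {b ε a : ℕ} : Reaches β w b → Edge β b ε a → Reaches β (w ++ [ε]) a

/-- The language `ℒ_β^{(a)}` of the admissible strings leading from the node `1` to `a`. -/
def language (β : ℝ) (a : ℕ) : Set (List ℕ) := {w | Admissible β w ∧ Reaches β w a}

/-- The value `w_p β^p + ⋯ + w_0` of the string `w_p ⋯ w_0`. -/
def value (β : ℝ) (w : List ℕ) : ℝ := w.foldl (fun v ε => v * β + ε) 0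

/-- The `β`-integers whose expansion belongs to `ℒ_β^{(a)}`. (Leading zeros are harmless: they
lead from the node `1` to itself, so they change neither the value nor the final node.) -/
def subInt (β : ℝ) (a : ℕ) : Set ℝ := value β '' language β a

/-! ### The complete representation space -/

/-- The field `ℚ(β)`. -/
abbrev K (β : ℝ) : Type := ℚ⟮β⟯

instance instNumberFieldK (β : ℝ) [h : Fact (IsPisot β)] : NumberField (K β) where
  to_charZero := inferInstance
  to_finiteDimensional :=
    adjoin.finiteDimensional (h.out.isIntegral.tower_top (A := ℚ))

/-- The infinite place of `ℚ(β)` given by the inclusion `ℚ(β) ⊆ ℝ`. -/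
def idPlace (β : ℝ) : NumberField.InfinitePlace (K β) :=
  .mk ((algebraMap ℝ ℂ).comp (algebraMap (K β) ℝ))

/-- `K_∞`: the product of the archimedean completions of `ℚ(β)` other than the usual one. -/
abbrev KInf (β : ℝ) : Type :=
  ∀ v : {v : NumberField.InfinitePlace (K β) // v ≠ idPlace β}, v.1.Completion

/-- The prime ideals of the ring of integers of `ℚ(β)` that contain `β`. -/
abbrev PrimesOver (β : ℝ) : Type :=
  {P : HeightOneSpectrum (𝓞 (K β)) // ∃ b ∈ P.asIdeal, ((b : K β) : ℝ) = β}

/-- `K_f`: the product of the completions `K_𝔓` over the prime ideals `𝔓` containing `β`. -/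
abbrev KFin (β : ℝ) [Fact (IsPisot β)] : Type :=
  ∀ P : PrimesOver β, P.1.adicCompletion (K β)

/-- The complete representation space `K_β = K_∞ × K_f`, with the product topology. -/
abbrev KBeta (β : ℝ) [Fact (IsPisot β)] : Type := KInf β × KFin β

instance instMeasurableSpaceKBeta (β : ℝ) [Fact (IsPisot β)] : MeasurableSpace (KBeta β) :=
  borel _

instance instBorelSpaceKBeta (β : ℝ) [Fact (IsPisot β)] : BorelSpace (KBeta β) := ⟨rfl⟩

/-- The diagonal embedding `φ_β : ℚ(β) → K_β`. -/
def phi (β : ℝ) [Fact (IsPisot β)] : K β →+* KBeta β :=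
  RingHom.prod (RingHom.pi fun v => algebraMap (K β) v.1.Completion)
    (RingHom.pi fun P => algebraMap (K β) (P.1.adicCompletion (K β)))

/-! ### Tiles -/

/-- The set `ℤ[1/β] ∩ [0,1)`, as a subset of `ℚ(β)`. -/
def tileIndex (β : ℝ) : Set (K β) := {x | (x : ℝ) ∈ zInv β ∧ 0 ≤ (x : ℝ) ∧ (x : ℝ) < 1}

/-- The complete `x`-tile: the closure of `φ_β({y ≥ 0 : {y}_β = x})`. (Since `y` and `{y}_β`
differ by an element of `ℤ[β]`, every such `y` belongs to `ℚ(β)`.) -/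
def tile (β : ℝ) [Fact (IsPisot β)] (x : K β) : Set (KBeta β) :=
  closure (phi β '' {y | 0 ≤ (y : ℝ) ∧ betaFract β y = x})

/-- The complete central `a`-subtile. -/
def subtile (β : ℝ) [Fact (IsPisot β)] (a : ℕ) : Set (KBeta β) :=
  closure (phi β '' {y | (y : ℝ) ∈ subInt β a})

/-- The translate of the complete central `a`-subtile by `φ_β(x)`. -/
def subtileAt (β : ℝ) [Fact (IsPisot β)] (a : ℕ) (x : K β) : Set (KBeta β) :=
  (fun z => z + phi β x) '' subtile β a

/-- The pairs `(a, x)` with `a ∈ {1, …, n}`, `x ∈ ℤ[1/β] ∩ [0,1)` and `x < T_β^{a-1}(1)`. For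
given `x`, these are the `a` for which `subtileAt β a x` is a part of the complete `x`-tile. -/
def subtileIndex (β : ℝ) : Set (ℕ × K β) :=
  {p | 1 ≤ p.1 ∧ p.1 ≤ nodeCount β ∧ p.2 ∈ tileIndex β ∧
    (p.2 : ℝ) < (betaMap β)^[p.1 - 1] 1}

/-- The point `z` is exclusive in the member `T i` of the family `(T j)_{j ∈ S}`. -/
def IsExclusive {ι E : Type*} (S : Set ι) (T : ι → Set E) (i : ι) (z : E) : Prop :=
  z ∈ T i ∧ ∀ j ∈ S, j ≠ i → z ∉ T j

end BetaTile

end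

noncomputable section

namespace BetaTile

/-! ### The quasi-greedy orbit of one -/

/-! Let `D` be the set of non-negative elements of ℤ[1/β]. Every tile and subtile is the closure of
`φ(A)` for some `A ⊆ D`, the sets `A` of one family are disjoint, and `φ(D)` is dense
(`dense_phi_zInvNonneg`). The heart is local exclusivity: if `s ∈ A`, then `φ(s)` is not in the
closure of `φ(D \ A)`. The complement of that closure is then an open set lying between `φ(A)` and
its closure, and the topological assertions follow formally.

Exclusivity comes from (F). Multiplication by `φ(β)` is a contraction, so integer parts have bounded
images; and ℤ[1/β] is discrete in `K_β × ℝ`. Hence the elements `u ∈ D` with `‖φ(u)‖ ≤ 1` have only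
finitely many fractional parts, and by (F) one power `β^L` turns all these `u` into β-integers.
After rescaling, every `u ∈ D` with `φ(u)` near `0` is a β-integer (`exists_ball_zero`). Near a
β-integer `y` with node `a`, one has `u = β^k v + y` with a β-integer `v`: the string of `v`, enough
zeros to return to node `1`, and the string of `y` form a path to `a` (`exists_ball_subInt`).

All boundaries lie in one closed set `N` (`exceptionalSet`). Its complement is stable under `φ(β)`,
and balls of one fixed radius around the relatively dense set `φ(X)` miss `N`. Contracting these
balls gives `N` holes of proportional size at arbitrarily small scales, so `N` is null
(`measure_eq_zero_of_porous`).

The combinatorics rests on (F) making `d_β(1)` finite: `d*_β(1)` is purely periodic, and node `a`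
stands for the remainders in `[0, T_β^{a-1}(1))`. -/

/-- The orbit of `1` under the quasi-greedy transformation `x ↦ βx - (⌈βx⌉ - 1)` of `(0,1]`. -/
def quasiOrbit (β : ℝ) : ℕ → ℝ
  | 0 => 1
  | i + 1 => β * quasiOrbit β i - (⌈β * quasiOrbit β i⌉ - 1 : ℤ)

/-- The digits of the quasi-greedy expansion of `1`. -/
def quasiDigit (β : ℝ) (i : ℕ) : ℕ := (⌈β * quasiOrbit β i⌉ - 1).toNat

/-- The length of the expansion `d_β(1)`, if this is finite. -/
def expLength (β : ℝ) : ℕ := sInf {N | ∀ i ≥ N, digit β 1 i = 0}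

lemma quasiOrbit_mem {β : ℝ} (i : ℕ) : 0 < quasiOrbit β i ∧ quasiOrbit β i ≤ 1 := by
  cases i with
  | zero => simp [quasiOrbit]
  | succ i =>
    have h1 := Int.le_ceil (β * quasiOrbit β i)
    have h2 := Int.ceil_lt_add_one (β * quasiOrbit β i)
    simp only [quasiOrbit]
    push_cast
    constructor <;> linarith

lemma quasiDigit_cast {β : ℝ} (hβ : 1 < β) (i : ℕ) :
    (quasiDigit β i : ℤ) = ⌈β * quasiOrbit β i⌉ - 1 := by
  have : 0 < ⌈β * quasiOrbit β i⌉ :=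
    Int.ceil_pos.2 (mul_pos (by linarith) (quasiOrbit_mem i).1)
  simp only [quasiDigit]
  omega

lemma quasiOrbit_succ {β : ℝ} (hβ : 1 < β) (i : ℕ) :
    quasiOrbit β (i + 1) = β * quasiOrbit β i - quasiDigit β i := by
  have := quasiDigit_cast hβ i
  have h : ((quasiDigit β i : ℤ) : ℝ) = ((⌈β * quasiOrbit β i⌉ - 1 : ℤ) : ℝ) := by rw [this]
  simp only [quasiOrbit]
  rw [← h]
  push_cast
  ring

lemma quasiDigit_zero_pos {β : ℝ} (hβ : 1 < β) : 0 < quasiDigit β 0 := by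
  have h := quasiDigit_cast hβ 0
  have : 1 < ⌈β * quasiOrbit β 0⌉ := by
    rw [Int.lt_ceil]
    simpa [quasiOrbit] using hβ
  omega

lemma quasiDigit_lt {β : ℝ} (hβ : 1 < β) (i : ℕ) : (quasiDigit β i : ℝ) < β := by
  have h := quasiOrbit_succ hβ i
  have h1 := (quasiOrbit_mem (β := β) (i + 1)).1
  have h2 := (quasiOrbit_mem (β := β) i).2
  nlinarith

/-- The lexicographic Parry condition. -/
lemma quasiDigit_shift_le {β : ℝ} (hβ : 1 < β) (k : ℕ) :
    toLex (fun i => quasiDigit β (k + i)) ≤ toLex (quasiDigit β) := by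
  refine not_lt.1 fun h => ?_
  obtain ⟨i, heq, hlt⟩ :
    ∃ i, (∀ j < i, quasiDigit β j = quasiDigit β (k + j)) ∧
      quasiDigit β i < quasiDigit β (k + i) := h
  -- Up to the first difference the digits agree, so the inequality with `quasiOrbit β 0 = 1`
  -- propagates; a larger digit at `i` would contradict monotonicity of the ceiling.
  have key : ∀ j ≤ i, quasiOrbit β (k + j) ≤ quasiOrbit β j := by
    intro j hj
    induction j with
    | zero => exact (quasiOrbit_mem k).2
    | succ j ih =>
      rw [← add_assoc, quasiOrbit_succ hβ, quasiOrbit_succ hβ, heq j hj]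
      have := ih (by omega)
      nlinarith
  have h1 := quasiDigit_cast hβ i
  have h2 := quasiDigit_cast hβ (k + i)
  have : ⌈β * quasiOrbit β (k + i)⌉ ≤ ⌈β * quasiOrbit β i⌉ :=
    Int.ceil_le_ceil (mul_le_mul_of_nonneg_left (key i le_rfl) (by linarith))
  omega

/-- Orbits with equal digits separate by the factor `β` at each step, yet stay in `(0,1]`. -/
lemma quasiOrbit_eq_of_digits {β : ℝ} (hβ : 1 < β) {p : ℕ}
    (h : ∀ i, quasiDigit β (i + p) = quasiDigit β i) : quasiOrbit β p = 1 := by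
  have key : ∀ i, quasiOrbit β (i + p) - quasiOrbit β i = β ^ i * (quasiOrbit β p - 1) := by
    intro i
    induction i with
    | zero => simp [quasiOrbit]
    | succ i ih =>
      rw [add_right_comm, quasiOrbit_succ hβ, quasiOrbit_succ hβ, h, pow_succ]
      linear_combination β * ih
  by_contra hne
  have hpos : 0 < |quasiOrbit β p - 1| := abs_pos.2 (sub_ne_zero.2 hne)
  obtain ⟨i, hi⟩ := pow_unbounded_of_one_lt (1 / |quasiOrbit β p - 1|) hβ
  rw [div_lt_iff₀ hpos] at hi
  have h1 := congrArg abs (key i)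
  rw [abs_mul, abs_of_pos (pow_pos (by linarith : (0:ℝ) < β) i)] at h1
  have h2 : |quasiOrbit β (i + p) - quasiOrbit β i| ≤ 1 := by
    rw [abs_le]
    constructor <;>
      linarith [(quasiOrbit_mem (β := β) i).1, (quasiOrbit_mem (β := β) i).2,
        (quasiOrbit_mem (β := β) (i + p)).1, (quasiOrbit_mem (β := β) (i + p)).2]
  linarith

/-! ### Orbits of the β-transformation -/

lemma betaMap_iterate_mem {β x : ℝ} (h0 : 0 ≤ x) (h1 : x ≤ 1) (i : ℕ) :
    0 ≤ (betaMap β)^[i] x ∧ (betaMap β)^[i] x ≤ 1 := by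
  cases i with
  | zero => exact ⟨h0, h1⟩
  | succ i =>
    rw [Function.iterate_succ_apply']
    exact ⟨Int.fract_nonneg _, (Int.fract_lt_one _).le⟩

/-- While the digits vanish, the map is multiplication by `β`; a nonzero orbit would leave `[0,1]`.
-/
lemma betaMap_iterate_eq_zero_of_digit {β x : ℝ} (hβ : 1 < β) (h0 : 0 ≤ x) (h1 : x ≤ 1) {N : ℕ}
    (h : ∀ i ≥ N, digit β x i = 0) : (betaMap β)^[N] x = 0 := by
  have key : ∀ k, (betaMap β)^[N + k] x = β ^ k * (betaMap β)^[N] x := by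
    intro k
    induction k with
    | zero => simp
    | succ k ih =>
      have h2 := h (N + k) (by omega)
      have h3 := (betaMap_iterate_mem (β := β) h0 h1 (N + k)).1
      rw [digit, Nat.floor_eq_zero] at h2
      rw [← add_assoc, Function.iterate_succ_apply', betaMap,
        Int.fract_eq_self.2 ⟨mul_nonneg (by linarith) h3, h2⟩, ih, pow_succ]
      ring
  by_contra hne
  have hpos : 0 < (betaMap β)^[N] x :=
    lt_of_le_of_ne (betaMap_iterate_mem h0 h1 N).1 (Ne.symm hne)
  obtain ⟨i, hi⟩ := pow_unbounded_of_one_lt (1 / (betaMap β)^[N] x) hβ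
  rw [div_lt_iff₀ hpos, ← key] at hi
  linarith [(betaMap_iterate_mem (β := β) h0 h1 (N + i)).2]

lemma betaMap_zero (β : ℝ) : betaMap β 0 = 0 := by simp [betaMap]

lemma digit_eq_zero_of_iterate {β x : ℝ} {j : ℕ} (h : (betaMap β)^[j] x = 0) :
    ∀ i ≥ j, digit β x i = 0 := by
  intro i hi
  obtain ⟨k, rfl⟩ := Nat.exists_eq_add_of_le hi
  have : (betaMap β)^[j + k] x = 0 := by
    rw [add_comm, Function.iterate_add_apply, h]
    exact Function.iterate_fixed (betaMap_zero β) k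
  simp [digit, this]

/-! ### Finite expansion of `1`: pure periodicity and the admissibility graph -/

section Finite

variable {β : ℝ} (hβ : 1 < β) (hfin : HasFiniteExpansion β 1)
include hβ hfin

lemma iterate_expLength : (betaMap β)^[expLength β] 1 = 0 :=
  betaMap_iterate_eq_zero_of_digit hβ zero_le_one le_rfl (Nat.sInf_mem hfin)

omit hβ hfin in
lemma iterate_ne_zero {i : ℕ} (hi : i < expLength β) : (betaMap β)^[i] 1 ≠ 0 := fun h =>
  Nat.notMem_of_lt_sInf hi (digit_eq_zero_of_iterate h)

lemma expLength_pos : 0 < expLength β := by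
  rw [Nat.pos_iff_ne_zero]
  intro h
  have := iterate_expLength hβ hfin
  simp [h] at this

omit hfin hβ in
-- `⌈t⌉ - 1` and `⌊t⌋` differ only at integers, and `βT^i(1)` is an integer only when the next
-- iterate is `0`.
lemma quasiOrbit_eq_iterate {i : ℕ} (hi : i < expLength β) :
    quasiOrbit β i = (betaMap β)^[i] 1 := by
  induction i with
  | zero => rfl
  | succ i ih =>
    have h := iterate_ne_zero hi
    rw [Function.iterate_succ_apply', ← ih (by omega)] at h ⊢
    simp only [quasiOrbit, betaMap]
    rw [Int.ceil_eq_floor_add_one_iff_notMem _ |>.2 fun hm => h (by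
      obtain ⟨z, hz⟩ := hm
      rw [betaMap, ← hz]
      simp)]
    rw [Int.fract]
    push_cast
    ring

/-- At the last nonzero digit `βT^i(1)` is an integer; the quasi-greedy rule then leaves remainder
`1` in place of `0`. -/
lemma quasiOrbit_expLength : quasiOrbit β (expLength β) = 1 := by
  have hpos := expLength_pos hβ hfin
  have h := iterate_expLength hβ hfin
  obtain ⟨k, hk⟩ := Nat.exists_eq_succ_of_ne_zero hpos.ne'
  rw [hk, Nat.succ_eq_add_one] at h ⊢
  rw [Function.iterate_succ_apply', ← quasiOrbit_eq_iterate (by omega), betaMap,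
    Int.fract_eq_zero_iff] at h
  obtain ⟨z, hz⟩ := h
  simp only [quasiOrbit]
  rw [← hz]
  simp

lemma quasiOrbit_periodic : Function.Periodic (quasiOrbit β) (expLength β) := by
  intro i
  induction i with
  | zero => rw [zero_add, quasiOrbit_expLength hβ hfin]; rfl
  | succ i ih => rw [add_right_comm]; simp only [quasiOrbit]; rw [ih]

lemma dStar_eq_quasiDigit (i : ℕ) : dStar β i = quasiDigit β i := by
  have hpos := expLength_pos hβ hfin
  have hmod : i % expLength β < expLength β := Nat.mod_lt _ hpos
  have hq : quasiDigit β i = quasiDigit β (i % expLength β) := by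
    simp only [quasiDigit, (quasiOrbit_periodic hβ hfin).map_mod_nat]
  have hx := (betaMap_iterate_mem (β := β) zero_le_one le_rfl (i % expLength β)).1
  have hd : (digit β 1 (i % expLength β) : ℤ) = ⌊β * quasiOrbit β (i % expLength β)⌋ := by
    rw [digit, ← quasiOrbit_eq_iterate hmod] at *
    exact Int.natCast_floor_eq_floor (mul_nonneg (by linarith) hx)
  have hc := quasiDigit_cast hβ (i % expLength β)
  rw [hq, dStar, if_pos hfin]
  change (if i % expLength β = expLength β - 1 then digit β 1 (expLength β - 1) - 1
    else digit β 1 (i % expLength β)) = _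
  -- At the end of the period `β` times the orbit point is an integer, so the quasi-greedy digit is
  -- the greedy one minus `1`; elsewhere the two agree.
  split_ifs with h
  · have hN := iterate_expLength hβ hfin
    have hs : expLength β = (i % expLength β) + 1 := by omega
    rw [hs, Function.iterate_succ_apply', ← quasiOrbit_eq_iterate hmod, betaMap,
      Int.fract_eq_zero_iff] at hN
    rw [← h]
    obtain ⟨z, hz⟩ := hN
    rw [← hz] at hc hd
    simp only [Int.ceil_intCast, Int.floor_intCast] at hc hd
    omega
  · have h1 := iterate_ne_zero (β := β) (i := i % expLength β + 1) (by omega)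
    rw [Function.iterate_succ_apply', ← quasiOrbit_eq_iterate hmod] at h1
    rw [Int.ceil_eq_floor_add_one_iff_notMem _ |>.2 fun hm => h1 (by
      obtain ⟨z, hz⟩ := hm
      rw [betaMap, ← hz]
      simp)] at hc
    omega

lemma quasiDigit_periodic : Function.Periodic (quasiDigit β) (expLength β) := fun i => by
  simp only [quasiDigit, quasiOrbit_periodic hβ hfin i]

lemma preperiod_eq_zero : preperiod β = 0 := by
  refine Nat.sInf_eq_zero.2 (Or.inl ⟨expLength β, expLength_pos hβ hfin, fun i _ => ?_⟩)
  rw [dStar_eq_quasiDigit hβ hfin, dStar_eq_quasiDigit hβ hfin, quasiDigit_periodic hβ hfin]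

lemma nodeCount_eq : nodeCount β = expLength β := by
  rw [nodeCount, preperiod_eq_zero hβ hfin, zero_add, period, preperiod_eq_zero hβ hfin]
  have hmem : expLength β ∈ {p | 1 ≤ p ∧ ∀ i ≥ 0, dStar β (i + p) = dStar β i} :=
    ⟨expLength_pos hβ hfin, fun i _ => by
      rw [dStar_eq_quasiDigit hβ hfin, dStar_eq_quasiDigit hβ hfin, quasiDigit_periodic hβ hfin]⟩
  refine le_antisymm (Nat.sInf_le hmem) (le_csInf ⟨_, hmem⟩ ?_)
  rintro p ⟨hp, h⟩
  by_contra! hlt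
  -- A shorter period would bring the orbit back to `1`, but later greedy iterates are fractional
  -- parts.
  have h1 : quasiOrbit β p = 1 := quasiOrbit_eq_of_digits hβ fun i => by
    rw [← dStar_eq_quasiDigit hβ hfin, ← dStar_eq_quasiDigit hβ hfin, h i (Nat.zero_le _)]
  rw [quasiOrbit_eq_iterate hlt] at h1
  obtain ⟨k, rfl⟩ := Nat.exists_eq_add_of_le' hp
  rw [Function.iterate_succ_apply'] at h1
  exact (Int.fract_lt_one _).ne h1

lemma edge_iff {b ε a : ℕ} : Edge β b ε a ↔
    (ε < quasiDigit β (b - 1) ∧ a = 1) ∨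
    (ε = quasiDigit β (b - 1) ∧ a = if b = expLength β then 1 else b + 1) := by
  rw [Edge, parryDigit, dStar_eq_quasiDigit hβ hfin, preperiod_eq_zero hβ hfin,
    nodeCount_eq hβ hfin]

lemma edge_node {b ε a : ℕ} (hb : b ≤ expLength β) (h : Edge β b ε a) :
    1 ≤ a ∧ a ≤ expLength β := by
  have := expLength_pos hβ hfin
  rcases (edge_iff hβ hfin).1 h with ⟨_, rfl⟩ | ⟨_, rfl⟩
  · omega
  · split_ifs <;> omega

lemma reaches_node {w : List ℕ} {a : ℕ} (h : Reaches β w a) : 1 ≤ a ∧ a ≤ expLength β := by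
  induction h with
  | nil => exact ⟨le_rfl, expLength_pos hβ hfin⟩
  | snoc _ he ih => exact edge_node hβ hfin ih.2 he

/-- The last edge of a node carries the digit of the quasi-greedy expansion. -/
lemma quasiOrbit_next {b : ℕ} (hb : 1 ≤ b) :
    quasiOrbit β ((if b = expLength β then 1 else b + 1) - 1) =
      β * quasiOrbit β (b - 1) - quasiDigit β (b - 1) := by
  rw [← quasiOrbit_succ hβ, Nat.sub_add_cancel hb]
  split_ifs with h
  · rw [h, quasiOrbit_expLength hβ hfin]; rfl
  · simp

lemma quasiDigit_next {b : ℕ} (hb : 1 ≤ b) (i : ℕ) :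
    quasiDigit β ((if b = expLength β then 1 else b + 1) - 1 + i) =
      quasiDigit β (b - 1 + (i + 1)) := by
  have : b - 1 + (i + 1) = b + i := by omega
  rw [this]
  split_ifs with h
  · rw [h, add_comm (expLength β), quasiDigit_periodic hβ hfin]; simp
  · simp

/-! ### Admissibility -/

omit hβ hfin in
/-- Two ways to be smaller than a sequence after prepending a digit. -/
lemma cons_lt_of {ε : ℕ} {s u : ℕ → ℕ}
    (h : ε < u 0 ∨ (ε = u 0 ∧ toLex s < toLex fun i => u (i + 1))) :
    toLex (fun i : ℕ => Nat.casesOn i ε s : ℕ → ℕ) < toLex u := by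
  rcases h with h | ⟨h, i, hi, hlt⟩
  · exact ⟨0, by simp, h⟩
  · refine ⟨i + 1, fun j hj => ?_, hlt⟩
    cases j with
    | zero => exact h
    | succ j => exact hi j (by omega)

/-- The sequence obtained by prepending a string. -/
def prepend (w : List ℕ) (s : ℕ → ℕ) : ℕ → ℕ :=
  w.foldr (fun ε s => fun i => Nat.casesOn i ε s) s

omit hβ hfin in
lemma prepend_zero (w : List ℕ) (i : ℕ) : prepend w (fun _ => 0) i = w.getD i 0 := by
  induction w generalizing i with
  | nil => simp [prepend]
  | cons ε w ih =>
    cases i with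
    | zero => rfl
    | succ i => simpa [prepend] using ih i

/-- The tail `s` is arbitrary so that the induction can move the last digit of the path into it: an
edge `b → a` turns a tail below the shift at `a` into a tail below the shift at `b`. The empty
suffix is the Parry condition. -/
lemma prepend_lt {w : List ℕ} {a : ℕ} (h : Reaches β w a) (s : ℕ → ℕ)
    (hs : toLex s < toLex fun i => quasiDigit β (a - 1 + i)) (v : List ℕ) (hv : v <:+ w) :
    toLex (prepend v s) < toLex (quasiDigit β) := by
  induction h generalizing s v with
  | nil =>
    rw [List.suffix_nil.1 hv]
    simpa [prepend] using hs
  | @snoc w b ε a hr he ih =>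
    rcases List.suffix_concat_iff.1 (by simpa [List.concat_eq_append] using hv) with
      rfl | ⟨t, ht, hvt⟩
    · exact hs.trans_le (quasiDigit_shift_le hβ _)
    · rw [ht, prepend, List.foldr_append]
      refine ih _ (cons_lt_of ?_) t hvt
      rcases (edge_iff hβ hfin).1 he with ⟨h1, rfl⟩ | ⟨h1, rfl⟩
      · exact Or.inl h1
      · refine Or.inr ⟨h1, ?_⟩
        simp only [quasiDigit_next hβ hfin (reaches_node hβ hfin hr).1] at hs
        exact hs

lemma zero_lt_shift (k : ℕ) : toLex (fun _ : ℕ => 0) < toLex fun i => quasiDigit β (k + i) := by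
  have hN := expLength_pos hβ hfin
  have hex : ∃ i, 0 < quasiDigit β (k + i) := by
    refine ⟨(expLength β - k % expLength β), ?_⟩
    have h1 := (quasiDigit_periodic hβ hfin).map_mod_nat (k + (expLength β - k % expLength β))
    have h2 : (k + (expLength β - k % expLength β)) % expLength β = 0 := by
      have h3 := Nat.mod_lt k hN
      have h4 := Nat.div_add_mod k (expLength β)
      have : k + (expLength β - k % expLength β) = expLength β * (k / expLength β + 1) := by
        rw [mul_add]; omega
      rw [this, Nat.mul_mod_right]
    rw [← h1, h2]
    exact quasiDigit_zero_pos hβ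
  classical
  exact ⟨Nat.find hex, fun j hj => by
    have := Nat.find_min hex hj
    change (0 : ℕ) = quasiDigit β (k + j)
    omega, Nat.find_spec hex⟩

/-- This makes the admissibility clause of `language` automatic. The zero tail is allowed because
each shift of `d*_β(1)` has a nonzero digit. -/
lemma admissible_of_reaches {w : List ℕ} {a : ℕ} (h : Reaches β w a) : Admissible β w := by
  intro k
  have h1 := prepend_lt hβ hfin h (fun _ => 0) (zero_lt_shift hβ hfin _) (w.drop k)
    (List.drop_suffix _ _)
  have h2 : dStar β = quasiDigit β := funext (dStar_eq_quasiDigit hβ hfin)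
  rw [h2]
  convert! h1 using 2
  funext i
  rw [prepend_zero]
  simp [List.getD_eq_getElem?_getD]

lemma language_eq (a : ℕ) : language β a = {w | Reaches β w a} := by
  ext w
  exact ⟨fun h => h.2, fun h => ⟨admissible_of_reaches hβ hfin h, h⟩⟩

lemma mem_subInt {y : ℝ} {a : ℕ} : y ∈ subInt β a ↔ ∃ w, Reaches β w a ∧ value β w = y := by
  rw [subInt, language_eq hβ hfin]; rfl

end Finite

/-! ### Beta-expansions of non-negative reals -/

lemma value_snoc (β : ℝ) (w : List ℕ) (ε : ℕ) : value β (w ++ [ε]) = value β w * β + ε := by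
  simp [value]

lemma value_nil (β : ℝ) : value β [] = 0 := rfl

lemma value_append (β : ℝ) (w v : List ℕ) :
    value β (w ++ v) = value β w * β ^ v.length + value β v := by
  induction v using List.reverseRecOn with
  | nil => simp [value_nil]
  | append_singleton v ε ih =>
    rw [← List.append_assoc, value_snoc, value_snoc, ih, List.length_append, List.length_singleton,
      pow_succ]
    ring

lemma value_replicate (β : ℝ) (k : ℕ) : value β (List.replicate k 0) = 0 := by
  induction k with
  | zero => rfl
  | succ k ih => rw [List.replicate_succ', value_snoc, ih]; simp

lemma value_nonneg {β : ℝ} (hβ : 0 ≤ β) (w : List ℕ) : 0 ≤ value β w := by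
  induction w using List.reverseRecOn with
  | nil => exact le_rfl
  | append_singleton w ε ih => rw [value_snoc]; positivity

/-- Dividing by a higher power of `β` only adds leading zeros, so the minimal `p` in `betaFract` may
be replaced by any larger one. -/
lemma iterate_div_pow {β y : ℝ} (hβ : 1 < β) (h0 : 0 ≤ y) {p q : ℕ} (hp : y < β ^ p)
    (hpq : p ≤ q) : (betaMap β)^[q] (y / β ^ q) = (betaMap β)^[p] (y / β ^ p) := by
  induction q, hpq using Nat.le_induction with
  | base => rfl
  | succ q hq ih =>
    have hβ0 : (0:ℝ) < β := by linarith
    have hlt : y < β ^ q := hp.trans_le (pow_le_pow_right₀ hβ.le hq)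
    have h1 : betaMap β (y / β ^ (q + 1)) = y / β ^ q := by
      have : β * (y / β ^ (q + 1)) = y / β ^ q := by
        rw [pow_succ]
        field_simp
      rw [betaMap, this, Int.fract_eq_self]
      exact ⟨by positivity, by rw [div_lt_one (by positivity)]; exact hlt⟩
    rw [Function.iterate_succ_apply, h1, ih]

lemma betaFract_eq {β y : ℝ} (hβ : 1 < β) (h0 : 0 ≤ y) {p : ℕ} (hp : y < β ^ p) :
    betaFract β y = (betaMap β)^[p] (y / β ^ p) := by
  have hne : {p : ℕ | y < β ^ p}.Nonempty := ⟨p, hp⟩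
  exact (iterate_div_pow hβ h0 (Nat.sInf_mem hne) (Nat.sInf_le hp)).symm

lemma betaMap_mem_zInv {β x : ℝ} (hβ : β ∈ zInv β) (hx : x ∈ zInv β) : betaMap β x ∈ zInv β := by
  rw [betaMap, Int.fract]
  exact sub_mem (mul_mem hβ hx) (intCast_mem _ _)

/-! ### Expansions of reals as paths with a remainder -/

section Finite

variable {β : ℝ} (hβ : 1 < β) (hfin : HasFiniteExpansion β 1)
include hβ hfin

/-- The digit `⌊βx⌋` labels an edge out of `b` if `x` is smaller than the bound of `b`. -/
lemma exists_edge {b : ℕ} (hb : 1 ≤ b) {x : ℝ} (h0 : 0 ≤ x) (hx : x < quasiOrbit β (b - 1)) :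
    ∃ a, Edge β b ⌊β * x⌋₊ a ∧ betaMap β x < quasiOrbit β (a - 1) := by
  have hn := quasiOrbit_next hβ hfin hb
  have hx0 : 0 ≤ β * x := mul_nonneg (by linarith) h0
  have hfl := Nat.floor_le hx0
  have hfr : betaMap β x = β * x - ⌊β * x⌋₊ := by
    rw [betaMap, ← Int.self_sub_floor, ← Int.natCast_floor_eq_floor hx0]
    simp
  have hlt : β * x < β * quasiOrbit β (b - 1) := mul_lt_mul_of_pos_left hx (by linarith)
  rcases lt_or_ge ⌊β * x⌋₊ (quasiDigit β (b - 1)) with h | h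
  · refine ⟨1, (edge_iff hβ hfin).2 (Or.inl ⟨h, rfl⟩), ?_⟩
    exact Int.fract_lt_one _
  · have hle : ⌊β * x⌋₊ ≤ quasiDigit β (b - 1) := by
      have h1 := (quasiOrbit_mem (β := β) ((if b = expLength β then 1 else b + 1) - 1)).2
      have : (⌊β * x⌋₊ : ℝ) < quasiDigit β (b - 1) + 1 := by linarith
      exact Nat.lt_succ_iff.1 (by exact_mod_cast this)
    have heq := le_antisymm hle h
    refine ⟨_, (edge_iff hβ hfin).2 (Or.inr ⟨heq, rfl⟩), ?_⟩
    rw [hn, hfr, heq]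
    linarith

/-- Reading an edge backwards. -/
lemma edge_bound {b ε a : ℕ} (hb : 1 ≤ b) (he : Edge β b ε a) {x : ℝ}
    (hx : x < quasiOrbit β (a - 1)) : (ε + x) / β < quasiOrbit β (b - 1) := by
  have hn := quasiOrbit_next hβ hfin hb
  rw [div_lt_iff₀ (by linarith), mul_comm]
  rcases (edge_iff hβ hfin).1 he with ⟨h1, rfl⟩ | ⟨rfl, rfl⟩
  · have h2 := (quasiOrbit_mem (β := β) ((if b = expLength β then 1 else b + 1) - 1)).1
    have h3 : (ε : ℝ) + 1 ≤ quasiDigit β (b - 1) := by exact_mod_cast h1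
    have h4 : quasiOrbit β (1 - 1) = 1 := rfl
    linarith
  · linarith

omit hβ hfin in
lemma edge_deterministic {b ε a a' : ℕ} (h : Edge β b ε a) (h' : Edge β b ε a') : a = a' := by
  rcases h with ⟨h1, h2⟩ | ⟨h1, h2⟩ <;> rcases h' with ⟨h3, h4⟩ | ⟨h3, h4⟩ <;> omega

/-- The final node records how large the remainder can be; the invariant `T^k x < quasiOrbit β (a -
1)` is what selects the next edge. -/
lemma exists_reaches {x : ℝ} (h0 : 0 ≤ x) (h1 : x < 1) (k : ℕ) :
    ∃ w a, w.length = k ∧ Reaches β w a ∧ x * β ^ k = value β w + (betaMap β)^[k] x ∧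
      (betaMap β)^[k] x < quasiOrbit β (a - 1) := by
  induction k with
  | zero => exact ⟨[], 1, rfl, Reaches.nil, by simp [value_nil], h1⟩
  | succ k ih =>
    obtain ⟨w, b, hl, hw, hv, hb⟩ := ih
    have hx0 := (betaMap_iterate_mem (β := β) h0 h1.le k).1
    obtain ⟨a, he, ha⟩ := exists_edge hβ hfin (reaches_node hβ hfin hw).1 hx0 hb
    refine ⟨_, a, by simp [hl], Reaches.snoc hw he, ?_, by rwa [Function.iterate_succ_apply']⟩
    rw [value_snoc, Function.iterate_succ_apply', pow_succ, ← mul_assoc, hv, betaMap]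
    have h2 := Int.self_sub_floor (β * (betaMap β)^[k] x)
    rw [← Int.natCast_floor_eq_floor (mul_nonneg (by linarith) hx0)] at h2
    push_cast at h2
    rw [← h2]
    ring

/-- Every non-negative number has a `β`-expansion. -/
lemma exists_expansion {u : ℝ} (h0 : 0 ≤ u) :
    ∃ w a, Reaches β w a ∧ u = value β w + betaFract β u ∧ 0 ≤ betaFract β u ∧
      betaFract β u < quasiOrbit β (a - 1) := by
  have hβ0 : 0 < β := by linarith
  obtain ⟨p, hp⟩ := pow_unbounded_of_one_lt u hβ
  have hx0 : 0 ≤ u / β ^ p := by positivity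
  have hx1 : u / β ^ p < 1 := by rwa [div_lt_one (by positivity)]
  obtain ⟨w, a, -, hw, hv, ha⟩ := exists_reaches hβ hfin hx0 hx1 p
  rw [betaFract_eq hβ h0 hp]
  refine ⟨w, a, hw, ?_, (betaMap_iterate_mem hx0 hx1.le p).1, ha⟩
  rw [← hv, div_mul_cancel₀ _ (by positivity)]

/-- Expansions of the same length are unique. -/
lemma expansion_unique {w : List ℕ} {a : ℕ} (h : Reaches β w a) {w' : List ℕ} {a' : ℕ}
    (h' : Reaches β w' a') (hl : w.length = w'.length) {x x' : ℝ} (h0 : 0 ≤ x)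
    (hx : x < quasiOrbit β (a - 1)) (h0' : 0 ≤ x') (hx' : x' < quasiOrbit β (a' - 1))
    (hv : value β w + x = value β w' + x') : w = w' ∧ a = a' ∧ x = x' := by
  induction h generalizing w' a' x x' with
  | nil =>
    cases h' with
    | nil => exact ⟨rfl, rfl, by simpa using hv⟩
    | snoc => simp at hl
  | @snoc v b ε a hr he ih =>
    cases h' with
    | nil => simp at hl
    | @snoc v' b' ε' _ hr' he' =>
      have hβ0 : 0 < β := by linarith
      rw [value_snoc, value_snoc] at hv
      -- Dividing by `β` absorbs the last digit into the remainder of the shorter string.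
      obtain ⟨rfl, rfl, h3⟩ := ih hr' (by simpa using hl) (x := (ε + x) / β) (x' := (ε' + x') / β)
        (by positivity) (edge_bound hβ hfin (reaches_node hβ hfin hr).1 he hx) (by positivity)
        (edge_bound hβ hfin (reaches_node hβ hfin hr').1 he' hx') (by
          field_simp
          linarith)
      rw [div_left_inj' hβ0.ne'] at h3
      have h4 := hx.trans_le (quasiOrbit_mem (a - 1)).2
      have h5 := hx'.trans_le (quasiOrbit_mem (a' - 1)).2
      have h6 : ε = ε' := by
        have h7 : (ε : ℝ) < ε' + 1 := by linarith
        have h8 : (ε' : ℝ) < ε + 1 := by linarith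
        have h7' : ε < ε' + 1 := by exact_mod_cast h7
        have h8' : ε' < ε + 1 := by exact_mod_cast h8
        omega
      subst h6
      exact ⟨rfl, edge_deterministic he he', by simpa using h3⟩

lemma reaches_zeros (k : ℕ) : Reaches β (List.replicate k 0) 1 := by
  induction k with
  | zero => exact Reaches.nil
  | succ k ih =>
    rw [List.replicate_succ']
    exact Reaches.snoc ih ((edge_iff hβ hfin).2 (Or.inl ⟨quasiDigit_zero_pos hβ, rfl⟩))

omit hβ hfin in
lemma reaches_append {v w : List ℕ} {a : ℕ} (hv : Reaches β v 1) (hw : Reaches β w a) :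
    Reaches β (v ++ w) a := by
  induction hw with
  | nil => simpa using hv
  | snoc _ he ih => rw [← List.append_assoc]; exact Reaches.snoc ih he

lemma reaches_pad {w : List ℕ} {a : ℕ} (hw : Reaches β w a) (k : ℕ) :
    Reaches β (List.replicate k 0 ++ w) a ∧ value β (List.replicate k 0 ++ w) = value β w :=
  ⟨reaches_append (reaches_zeros hβ hfin k) hw, by simp [value_append, value_replicate]⟩

/-- Padding two strings to the same length. -/
lemma exists_same_length {w w' : List ℕ} {a a' : ℕ} (hw : Reaches β w a)
    (hw' : Reaches β w' a') : ∃ v v', Reaches β v a ∧ Reaches β v' a' ∧ v.length = v'.length ∧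
      value β v = value β w ∧ value β v' = value β w' :=
  ⟨_, _, (reaches_pad hβ hfin hw w'.length).1, (reaches_pad hβ hfin hw' w.length).1,
    by simp [add_comm], (reaches_pad hβ hfin hw _).2, (reaches_pad hβ hfin hw' _).2⟩

lemma decomposition_unique {y y' x x' : ℝ} {a a' : ℕ} (hy : y ∈ subInt β a)
    (hy' : y' ∈ subInt β a') (h0 : 0 ≤ x) (hx : x < quasiOrbit β (a - 1)) (h0' : 0 ≤ x')
    (hx' : x' < quasiOrbit β (a' - 1)) (h : y + x = y' + x') : a = a' ∧ x = x' := by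
  obtain ⟨w, hw, rfl⟩ := (mem_subInt hβ hfin).1 hy
  obtain ⟨w', hw', rfl⟩ := (mem_subInt hβ hfin).1 hy'
  obtain ⟨v, v', hv, hv', hl, e, e'⟩ := exists_same_length hβ hfin hw hw'
  exact (expansion_unique hβ hfin hv hv' hl h0 hx h0' hx' (by rw [e, e', h])).2

lemma exists_decomposition {u : ℝ} (h0 : 0 ≤ u) : ∃ a, 1 ≤ a ∧ a ≤ expLength β ∧
    ∃ y ∈ subInt β a, u = y + betaFract β u ∧ 0 ≤ betaFract β u ∧
      betaFract β u < quasiOrbit β (a - 1) := by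
  obtain ⟨w, a, hw, h⟩ := exists_expansion hβ hfin h0
  exact ⟨a, (reaches_node hβ hfin hw).1, (reaches_node hβ hfin hw).2, _,
    (mem_subInt hβ hfin).2 ⟨w, hw, rfl⟩, h⟩

omit hfin in
lemma subInt_nonneg {y : ℝ} {a : ℕ} (hy : y ∈ subInt β a) : 0 ≤ y := by
  obtain ⟨w, -, rfl⟩ := hy
  exact value_nonneg (by linarith) w

lemma betaFract_add {y x : ℝ} {a : ℕ} (hy : y ∈ subInt β a) (h0 : 0 ≤ x)
    (hx : x < quasiOrbit β (a - 1)) : betaFract β (y + x) = x := by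
  obtain ⟨a', -, -, y', hy', h, h0', hx'⟩ :=
    exists_decomposition hβ hfin (add_nonneg (subInt_nonneg hβ hy) h0)
  exact (decomposition_unique hβ hfin hy' hy h0' hx' h0 hx h.symm).2

/-- Different `β`-integers with the same node are at least `1` apart. -/
lemma value_eq_of_same_node {w : List ℕ} {a : ℕ} (h : Reaches β w a) {w' : List ℕ}
    (h' : Reaches β w' a) (hl : w.length = w'.length)
    (hv : |value β w - value β w'| < 1) : value β w = value β w' := by
  -- At node `1` every remainder in `[0,1)` is allowed, so the difference of the values can itself
  -- serve as a remainder.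
  have base : ∀ {w w' : List ℕ}, Reaches β w 1 → Reaches β w' 1 → w.length = w'.length →
      |value β w - value β w'| < 1 → value β w = value β w' := by
    intro w w' h h' hl hv
    have h1 : quasiOrbit β (1 - 1) = 1 := rfl
    rw [abs_lt] at hv
    rcases le_total (value β w) (value β w') with hle | hle
    · rw [(expansion_unique hβ hfin h h' hl (x := value β w' - value β w) (x' := 0)
        (by linarith) (by rw [h1]; linarith) le_rfl (by rw [h1]; linarith) (by ring)).1]
    · rw [(expansion_unique hβ hfin h h' hl (x := 0) (x' := value β w - value β w')
        le_rfl (by rw [h1]; linarith) (by linarith) (by rw [h1]; linarith) (by ring)).1]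
  induction h generalizing w' with
  | nil => exact base Reaches.nil h' hl hv
  | @snoc v b ε a hr he ih =>
    by_cases ha : a = 1
    · subst ha
      exact base (Reaches.snoc hr he) h' hl hv
    cases h' with
    | nil => simp at hl
    | @snoc v' b' ε' _ hr' he' =>
      have e1 := (edge_iff hβ hfin).1 he
      have e2 := (edge_iff hβ hfin).1 he'
      -- A node other than `1` is entered by one edge only, so the last digits agree and can be
      -- removed.
      have hb : b = b' := by split_ifs at e1 e2 <;> omega
      subst hb
      have hε : ε = ε' := by split_ifs at e1 e2 <;> omega
      subst hε
      rw [value_snoc, value_snoc] at hv ⊢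
      have hv' : β * |value β v - value β v'| < 1 := by
        rw [← abs_of_pos (by linarith : 0 < β), ← abs_mul, abs_of_pos (by linarith : 0 < β)]
        rwa [show β * (value β v - value β v') =
          value β v * β + ε - (value β v' * β + ε) by ring]
      rw [ih hr' (by simpa using hl) (by nlinarith [abs_nonneg (value β v - value β v')])]

/-- Here `x` and `x'` may exceed the bound of node `a`, so `decomposition_unique` does not apply;
the separation of β-integers with a common node replaces it. -/
lemma subInt_translate_unique {y y' x x' : ℝ} {a : ℕ} (hy : y ∈ subInt β a)
    (hy' : y' ∈ subInt β a) (h0 : 0 ≤ x) (hx : x < 1) (h0' : 0 ≤ x') (hx' : x' < 1)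
    (h : y + x = y' + x') : x = x' := by
  obtain ⟨w, hw, rfl⟩ := (mem_subInt hβ hfin).1 hy
  obtain ⟨w', hw', rfl⟩ := (mem_subInt hβ hfin).1 hy'
  obtain ⟨v, v', hv, hv', hl, e, e'⟩ := exists_same_length hβ hfin hw hw'
  have := value_eq_of_same_node hβ hfin hv hv' hl (by rw [e, e', abs_lt]; constructor <;> linarith)
  linarith

/-- The edge `⌊βx⌋` maps `y + x` to `βy + βx`. -/
lemma mul_mem_subInt {x : ℝ} {b : ℕ} (hb : 1 ≤ b) (hb' : b ≤ expLength β) (h0 : 0 ≤ x)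
    (hx : x < quasiOrbit β (b - 1)) : ∃ a, 1 ≤ a ∧ a ≤ expLength β ∧
      betaMap β x < quasiOrbit β (a - 1) ∧
      ∀ z ∈ subInt β b, ∃ z' ∈ subInt β a, β * (z + x) = z' + betaMap β x := by
  obtain ⟨a, he, ha⟩ := exists_edge hβ hfin hb h0 hx
  have hn := edge_node hβ hfin hb' he
  refine ⟨a, hn.1, hn.2, ha, fun z hz => ?_⟩
  obtain ⟨w', hw', rfl⟩ := (mem_subInt hβ hfin).1 hz
  refine ⟨_, (mem_subInt hβ hfin).2 ⟨_, Reaches.snoc hw' he, rfl⟩, ?_⟩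
  have h2 := Int.self_sub_floor (β * x)
  rw [← Int.natCast_floor_eq_floor (mul_nonneg (by linarith) h0)] at h2
  push_cast at h2
  rw [value_snoc, betaMap, ← h2]
  ring

/-- After enough zeros one is at the node `1`. -/
lemma reaches_append_zeros {w : List ℕ} {b : ℕ} (hw : Reaches β w b) (k : ℕ) :
    Reaches β (w ++ List.replicate k 0) 1 ∨
      (Reaches β (w ++ List.replicate k 0) (b + k)) := by
  induction k with
  | zero => right; simpa using hw
  | succ k ih =>
    rw [List.replicate_succ', ← List.append_assoc]
    rcases ih with h | h
    · exact Or.inl (Reaches.snoc h ((edge_iff hβ hfin).2 (Or.inl ⟨quasiDigit_zero_pos hβ, rfl⟩)))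
    · rcases Nat.eq_zero_or_pos (quasiDigit β (b + k - 1)) with h0 | h0
      · by_cases hN : b + k = expLength β
        · exact Or.inl (Reaches.snoc h ((edge_iff hβ hfin).2 (Or.inr ⟨h0.symm, by simp [hN]⟩)))
        · exact Or.inr (Reaches.snoc h ((edge_iff hβ hfin).2
            (Or.inr ⟨h0.symm, by rw [if_neg hN, add_assoc]⟩)))
      · exact Or.inl (Reaches.snoc h ((edge_iff hβ hfin).2 (Or.inl ⟨h0, rfl⟩)))

lemma reaches_zeros_one {w : List ℕ} {b : ℕ} (hw : Reaches β w b) :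
    Reaches β (w ++ List.replicate (expLength β) 0) 1 := by
  rcases reaches_append_zeros hβ hfin hw (expLength β) with h | h
  · exact h
  · have := (reaches_node hβ hfin h).2
    have := (reaches_node hβ hfin hw).1
    omega

/-- For a `β`-integer `y` with node `a`, adding large multiples `β^k v` of `β`-integers `v`
does not change the node. -/
lemma exists_add_mem_subInt {y : ℝ} {a : ℕ} (hy : y ∈ subInt β a) :
    ∃ k : ℕ, ∀ b, ∀ v ∈ subInt β b, v * β ^ k + y ∈ subInt β a := by
  obtain ⟨w, hw, rfl⟩ := (mem_subInt hβ hfin).1 hy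
  -- Enough zeros to return to node `1`, then room for the string of `y`.
  refine ⟨expLength β + w.length, fun b v hv => ?_⟩
  obtain ⟨w', hw', rfl⟩ := (mem_subInt hβ hfin).1 hv
  refine (mem_subInt hβ hfin).2
    ⟨_, reaches_append (reaches_zeros_one hβ hfin hw') hw, ?_⟩
  rw [value_append, value_append, value_replicate, List.length_replicate, pow_add]
  ring

lemma zero_mem_subInt : (0 : ℝ) ∈ subInt β 1 :=
  (mem_subInt hβ hfin).2 ⟨[], Reaches.nil, rfl⟩

/-- Induction over the `β`-integers, forgetting the node. -/
lemma subInt_induction {p : ℝ → Prop} (h0 : p 0)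
    (hs : ∀ v, p v → ∀ ε : ℕ, (ε : ℝ) < β → p (v * β + ε)) {y : ℝ} {a : ℕ}
    (hy : y ∈ subInt β a) : p y := by
  obtain ⟨w, hw, rfl⟩ := (mem_subInt hβ hfin).1 hy
  clear hy
  induction hw with
  | nil => exact h0
  | @snoc w b ε a hr he ih =>
    rw [value_snoc]
    refine hs _ ih _ ((Nat.cast_le.2 ?_).trans_lt (quasiDigit_lt hβ (b - 1)))
    rcases (edge_iff hβ hfin).1 he with h | h <;> omega

/-- A `β`-integer is recognized by the vanishing of its fractional part. -/
lemma exists_subInt_of_pow_mul {u : ℝ} (h0 : 0 ≤ u) {L : ℕ}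
    (hL : ∀ i ≥ L, digit β (betaFract β u) i = 0) : ∃ a, u * β ^ L ∈ subInt β a := by
  obtain ⟨a, -, -, y, hy, h, hx0, hx⟩ := exists_decomposition hβ hfin h0
  have hx1 : betaFract β u ≤ 1 := hx.le.trans (quasiOrbit_mem _).2
  have hz := betaMap_iterate_eq_zero_of_digit hβ hx0 hx1 hL
  -- Multiplication by `β` acts on the remainder as `T_β`, which reaches `0` after `L` steps.
  have key : ∀ k, ∃ a, ∃ z ∈ subInt β a, u * β ^ k = z + (betaMap β)^[k] (betaFract β u) ∧
      (betaMap β)^[k] (betaFract β u) < quasiOrbit β (a - 1) := by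
    intro k
    induction k with
    | zero => exact ⟨a, y, hy, by simpa using h, hx⟩
    | succ k ih =>
      obtain ⟨b, z, hz, e, hb⟩ := ih
      obtain ⟨w, hw, -⟩ := (mem_subInt hβ hfin).1 hz
      have hn := reaches_node hβ hfin hw
      obtain ⟨c, -, -, hc, hmul⟩ := mul_mem_subInt hβ hfin hn.1 hn.2
        (betaMap_iterate_mem hx0 hx1 k).1 hb
      obtain ⟨z', hz', e'⟩ := hmul z hz
      rw [Function.iterate_succ_apply']
      exact ⟨c, z', hz', by rw [← e', ← e, pow_succ]; ring, hc⟩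
  obtain ⟨a', z, hz', e, -⟩ := key L
  rw [hz, add_zero] at e
  exact ⟨a', e ▸ hz'⟩

end Finite

/-! ### The ring `ℤ[1/β]` -/

section Ring

variable {β : ℝ}

lemma inv_mem_zInv : β⁻¹ ∈ zInv β := Algebra.subset_adjoin (Set.mem_singleton _)

/-- Dividing the monic equation of degree `d + 1` by `β^d` expresses `β` as an integer polynomial in
`1/β`. -/
lemma mem_zInv (hβ : 0 < β) (hint : IsIntegral ℤ β) : β ∈ zInv β := by
  obtain ⟨p, hp, h0⟩ := hint
  have hβ0 := hβ.ne'
  have hd : p.natDegree ≠ 0 := by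
    intro hd
    rw [hp.natDegree_eq_zero.1 hd] at h0
    simp at h0
  obtain ⟨d, hd⟩ := Nat.exists_eq_succ_of_ne_zero hd
  rw [Polynomial.eval₂_eq_sum_range, hd, Finset.sum_range_succ, ← Nat.succ_eq_add_one, ← hd,
    Polynomial.Monic.coeff_natDegree hp, map_one, one_mul, hd, Nat.succ_eq_add_one] at h0
  have e : β = -∑ i ∈ Finset.range (d + 1), (p.coeff i : ℝ) * β⁻¹ ^ (d - i) := by
    have h1 : β ^ d * β = -(β ^ d * ∑ i ∈ Finset.range (d + 1), (p.coeff i : ℝ) * β⁻¹ ^ (d - i)) := by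
      rw [← pow_succ, eq_neg_iff_add_eq_zero, add_comm, ← h0, Finset.mul_sum]
      congr 1
      refine Finset.sum_congr rfl fun i hi => ?_
      have hi' : i ≤ d := Nat.lt_succ_iff.1 (Finset.mem_range.1 hi)
      have : β ^ d = β ^ i * β ^ (d - i) := by rw [← pow_add, Nat.add_sub_cancel' hi']
      rw [this, inv_pow]
      simp only [eq_intCast]
      field_simp
    rw [← mul_neg] at h1
    exact mul_left_cancel₀ (pow_ne_zero d hβ0) h1
  have hmem : -∑ i ∈ Finset.range (d + 1), (p.coeff i : ℝ) * β⁻¹ ^ (d - i) ∈ zInv β :=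
    neg_mem (sum_mem fun i _ => mul_mem (intCast_mem _ _) (pow_mem inv_mem_zInv _))
  rwa [← e] at hmem

/-- (F) only concerns `[0,1)`, so it is applied to `T_β(1)`, whose digits are those of `1` shifted
by one. -/
lemma hasFiniteExpansion_one (hβ : IsPisot β) (hF : FinitenessProperty β) :
    HasFiniteExpansion β 1 := by
  have hmem := mem_zInv (by linarith [hβ.one_lt]) hβ.isIntegral
  obtain ⟨N, hN⟩ := hF (betaMap β 1) (betaMap_mem_zInv hmem (one_mem _)) (Int.fract_nonneg _)
    (Int.fract_lt_one _)
  refine ⟨N + 1, fun i hi => ?_⟩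
  obtain ⟨j, rfl⟩ := Nat.exists_eq_add_of_le' (Nat.one_le_of_lt hi)
  have := hN j (by omega)
  rwa [digit, ← Function.iterate_succ_apply] at this

lemma subInt_subset_zInv (hβ : 1 < β) (hfin : HasFiniteExpansion β 1) (hmem : β ∈ zInv β)
    {y : ℝ} {a : ℕ} (hy : y ∈ subInt β a) : y ∈ zInv β :=
  subInt_induction hβ hfin (p := (· ∈ zInv β)) (zero_mem _)
    (fun _ hv ε _ => add_mem (mul_mem hv hmem) (natCast_mem _ ε)) hy

end Ring

/-! ### Compactness of the unit balls of the completions -/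

section Completion

open NumberField NumberField.HeightOneSpectrum

variable {F : Type*} [Field F] [NumberField F] (P : HeightOneSpectrum (𝓞 F))

lemma norm_algebraMap_adic (x : F) :
    ‖algebraMap F (P.adicCompletion F) x‖ = adicAbv F P x :=
  FinitePlace.norm_embedding P x

lemma adicAbv_lt_iff {x y : F} :
    adicAbv F P x < adicAbv F P y ↔ P.valuation F x < P.valuation F y := by
  rw [adicAbv_def, adicAbv_def, NNReal.coe_lt_coe]
  exact (WithZeroMulInt.toNNReal_strictMono (one_lt_absNorm_nnreal P)).lt_iff_lt

lemma adicAbv_le_one_iff {x : F} : adicAbv F P x ≤ 1 ↔ P.valuation F x ≤ 1 := by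
  have := adicAbv_lt_iff P (x := 1) (y := x)
  rw [map_one, map_one] at this
  rw [← not_lt, this, not_lt]

lemma exists_adicAbv_lt {ε : ℝ} (hε : 0 < ε) :
    ∃ c : 𝓞 F, c ≠ 0 ∧ adicAbv F P (c : F) < ε := by
  obtain ⟨c, hc, hc0⟩ := Submodule.exists_mem_ne_zero_of_ne_bot P.ne_bot
  have h1 : adicAbv F P (c : F) < 1 := by
    rw [← norm_algebraMap_adic]
    exact (FinitePlace.norm_lt_one_iff_mem F P c).2 hc
  obtain ⟨n, hn⟩ := exists_pow_lt_of_lt_one hε h1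
  exact ⟨c ^ n, pow_ne_zero n hc0, by simpa using hn⟩

/-- A point of the ball is approximated by a field element, then by an algebraic integer, then by a
representative of its class in the finite ring `𝓞 F / (c)`. -/
lemma totallyBounded_closedBall_adic :
    TotallyBounded (Metric.closedBall (0 : P.adicCompletion F) 1) := by
  rw [Metric.totallyBounded_iff]
  intro ε hε
  -- One third of `ε` for each approximation; the bound `1` keeps the field element integral at `P`.
  obtain ⟨c, hc0, hc⟩ := exists_adicAbv_lt P (show 0 < min 1 (ε / 3) by positivity)
  have hcpos : 0 < adicAbv F P (c : F) :=
    (adicAbv F P).pos (RingOfIntegers.coe_ne_zero_iff.2 hc0)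
  have hfin : Finite (𝓞 F ⧸ Ideal.span {c}) :=
    Ideal.finiteQuotientOfFreeOfNeBot _ (by simpa using hc0)
  refine ⟨Set.range fun q : 𝓞 F ⧸ Ideal.span {c} =>
    algebraMap F (P.adicCompletion F) (Quotient.out q : 𝓞 F), Set.finite_range _, fun z hz => ?_⟩
  rw [mem_closedBall_zero_iff] at hz
  have hdense : DenseRange (algebraMap F (P.adicCompletion F)) :=
    HeightOneSpectrum.denseRange_algebraMap F P
  obtain ⟨k, hk⟩ := hdense.exists_dist_lt z hcpos
  rw [dist_comm, dist_eq_norm] at hk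
  have hk1 : P.valuation F k ≤ 1 := by
    rw [← adicAbv_le_one_iff, ← norm_algebraMap_adic]
    have := IsUltrametricDist.norm_add_le_max z (algebraMap F (P.adicCompletion F) k - z)
    rw [add_sub_cancel] at this
    exact this.trans (max_le hz (hk.trans (hc.trans_le (min_le_left _ _))).le)
  obtain ⟨a, ha⟩ := P.exists_valuation_sub_lt_of_integer hk1
    (Units.mk0 (P.valuation F (c : F)) (by simpa using hc0))
  have ha' : adicAbv F P ((a : F) - k) < adicAbv F P (c : F) := (adicAbv_lt_iff P).2 ha
  obtain ⟨r, hr⟩ := Ideal.mem_span_singleton'.1 (Ideal.Quotient.eq.1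
    (Ideal.Quotient.mk_out (Ideal.Quotient.mk (Ideal.span {c}) a)))
  set q := Quotient.out (Ideal.Quotient.mk (Ideal.span {c}) a)
  have hq : adicAbv F P ((q : F) - a) ≤ adicAbv F P (c : F) := by
    have e : (q : F) - a = (r : F) * c := by exact_mod_cast congrArg (algebraMap (𝓞 F) F) hr.symm
    rw [e, map_mul]
    refine mul_le_of_le_one_left (apply_nonneg _ _) ?_
    rw [← norm_algebraMap_adic]
    exact FinitePlace.norm_le_one F P r
  refine Set.mem_iUnion₂.2 ⟨_, ⟨Ideal.Quotient.mk _ a, rfl⟩, ?_⟩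
  rw [Metric.mem_ball, dist_eq_norm]
  have e : z - algebraMap F (P.adicCompletion F) (q : F) =
      -(algebraMap F (P.adicCompletion F) k - z) -
        algebraMap F (P.adicCompletion F) ((a : F) - k) -
        algebraMap F (P.adicCompletion F) ((q : F) - a) := by
    simp only [map_sub]
    ring
  have h1 := norm_sub_le (-(algebraMap F (P.adicCompletion F) k - z) -
        algebraMap F (P.adicCompletion F) ((a : F) - k))
        (algebraMap F (P.adicCompletion F) ((q : F) - a))
  have h2 := norm_sub_le (-(algebraMap F (P.adicCompletion F) k - z))
        (algebraMap F (P.adicCompletion F) ((a : F) - k))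
  rw [norm_neg] at h2
  rw [norm_algebraMap_adic] at h1 h2
  rw [← e] at h1
  have h3 := hc.trans_le (min_le_right 1 (ε / 3))
  change ‖z - algebraMap F (P.adicCompletion F) (q : F)‖ < ε
  linarith

lemma properSpace_adicCompletion : ProperSpace (P.adicCompletion F) := by
  have hc : IsCompact (Metric.closedBall (0 : P.adicCompletion F) 1) :=
    (totallyBounded_closedBall_adic P).isCompact_of_isClosed
      Metric.isClosed_closedBall
  have := hc.locallyCompactSpace_of_mem_nhds_of_addGroup
    (Metric.closedBall_mem_nhds 0 one_pos)
  obtain ⟨c, hc0, hc⟩ := exists_adicAbv_lt P one_pos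
  let _ : NontriviallyNormedField (P.adicCompletion F) :=
    .ofNormNeOne ⟨algebraMap F (P.adicCompletion F) c,
      (map_ne_zero _).2 (RingOfIntegers.coe_ne_zero_iff.2 hc0), by
        rw [norm_algebraMap_adic]; exact hc.ne⟩
  exact .of_nontriviallyNormedField_of_weaklyLocallyCompactSpace (P.adicCompletion F)

omit [NumberField F] in
lemma properSpace_infiniteCompletion (v : InfinitePlace F) : ProperSpace v.Completion := by
  have h := InfinitePlace.Completion.isometry_extensionEmbedding v
  refine ⟨fun x r => ?_⟩
  rw [← h.preimage_closedBall]
  exact h.isClosedEmbedding.isCompact_preimage (isCompact_closedBall _ _)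

end Completion

/-! ### The normed representation space and the contraction by `β` -/

section Instances

open NumberField NumberField.HeightOneSpectrum

variable (β : ℝ) [hP : Fact (IsPisot β)]

/-- The generator `β` of `ℚ(β)`. -/
def gen : K β := AdjoinSimple.gen ℚ β

omit hP in
@[simp] lemma coe_gen : ((gen β : K β) : ℝ) = β := AdjoinSimple.coe_gen ℚ β

lemma gen_ne_zero : gen β ≠ 0 := by
  intro h
  have := coe_gen β
  rw [h] at this
  have := hP.out.one_lt
  simp at *
  linarith

lemma isIntegral_gen : IsIntegral ℤ (gen β) := by
  have := hP.out.isIntegral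
  rw [← coe_gen β] at this
  exact (isIntegral_algebraMap_iff (algebraMap (K β) ℝ).injective).1 this

/-- The generator `β` as an algebraic integer. -/
def intGen : 𝓞 (K β) := ⟨gen β, isIntegral_gen β⟩

lemma mem_primesOver_iff (P : HeightOneSpectrum (𝓞 (K β))) :
    (∃ b ∈ P.asIdeal, ((b : K β) : ℝ) = β) ↔ intGen β ∈ P.asIdeal := by
  constructor
  · rintro ⟨b, hb, h⟩
    have : b = intGen β := by
      apply RingOfIntegers.coe_injective
      apply Subtype.coe_injective
      exact h.trans (coe_gen β).symm
    rwa [← this]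
  · exact fun h => ⟨_, h, coe_gen β⟩

lemma finite_primesOver : Finite (PrimesOver β) := by
  have h0 : intGen β ≠ 0 := fun h => gen_ne_zero β (congrArg Subtype.val h)
  have := Ideal.finite_factors (I := Ideal.span {intGen β}) (by simpa using h0)
  refine (this.subset ?_).to_subtype
  intro P hP
  rw [Set.mem_ofPred_eq, Ideal.dvd_span_singleton]
  exact (mem_primesOver_iff β P).1 hP

/-- The primes above `β` form a finite type. -/
abbrev fintypePrimesOver : Fintype (PrimesOver β) :=
  have := finite_primesOver β
  Fintype.ofFinite _

attribute [local instance] fintypePrimesOver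

/-- The infinite places form a finite type. -/
abbrev fintypePlaces : Fintype {v : InfinitePlace (K β) // v ≠ idPlace β} :=
  Fintype.ofFinite _

attribute [local instance] fintypePlaces

/-- The maximum norm on the representation space. -/
abbrev normedCommRing : NormedCommRing (KBeta β) := inferInstance

lemma properSpace : @ProperSpace (KBeta β)
    (normedCommRing β).toSeminormedCommRing.toPseudoMetricSpace := by
  have (P : PrimesOver β) : ProperSpace (P.1.adicCompletion (K β)) := properSpace_adicCompletion _
  have (v : {v : InfinitePlace (K β) // v ≠ idPlace β}) : ProperSpace v.1.Completion :=
    properSpace_infiniteCompletion _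
  exact (inferInstance : ProperSpace (KInf β × KFin β))

attribute [local instance] normedCommRing properSpace

lemma norm_phi_le_iff {u : K β} {C : ℝ} (hC : 0 ≤ C) : ‖phi β u‖ ≤ C ↔
    (∀ v : InfinitePlace (K β), v ≠ idPlace β → v u ≤ C) ∧
      ∀ P : PrimesOver β, adicAbv (K β) P.1 u ≤ C := by
  rw [Prod.norm_def, max_le_iff, pi_norm_le_iff_of_nonneg hC, pi_norm_le_iff_of_nonneg hC]
  refine and_congr ⟨fun h v hv => ?_, fun h v => ?_⟩ (forall_congr' fun P => ?_)
  · have := h ⟨v, hv⟩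
    rwa [show (phi β u).1 ⟨v, hv⟩ = algebraMap (K β) v.Completion u from rfl,
      InfinitePlace.Completion.algebraMap_apply, InfinitePlace.Completion.norm_coe] at this
  · rw [show (phi β u).1 v = algebraMap (K β) v.1.Completion u from rfl,
      InfinitePlace.Completion.algebraMap_apply, InfinitePlace.Completion.norm_coe]
    exact h v.1 v.2
  · rw [← norm_algebraMap_adic]
    rfl

/-- The embedding of `v` sends `β` to a conjugate. If this is `β` itself, the embedding is the
inclusion, since `β` generates the field. -/
lemma place_gen_lt_one {v : InfinitePlace (K β)} (hv : v ≠ idPlace β) : v (gen β) < 1 := by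
  rw [← v.norm_embedding_eq]
  refine hP.out.norm_conj_lt _ ?_ fun h => hv ?_
  · have h1 : Polynomial.aeval (gen β) (minpoly ℚ β) = 0 := by
      apply (algebraMap (K β) ℝ).injective
      rw [map_zero, ← Polynomial.aeval_algebraMap_apply]
      exact (congrArg (fun x => Polynomial.aeval x (minpoly ℚ β)) (coe_gen β)).trans
        (minpoly.aeval ℚ β)
    have h2 : v.embedding (Polynomial.aeval (gen β) (minpoly ℚ β)) =
        Polynomial.aeval (v.embedding (gen β)) (minpoly ℚ β) :=
      (Polynomial.aeval_algHom_apply (RingHom.toRatAlgHom v.embedding) (gen β) _).symm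
    rw [← h2, h1, map_zero]
  · have h3 : RingHom.toRatAlgHom v.embedding =
        RingHom.toRatAlgHom ((algebraMap ℝ ℂ).comp (algebraMap (K β) ℝ)) := by
      refine (adjoin.powerBasis (hP.out.isIntegral.tower_top (A := ℚ))).algHom_ext ?_
      rw [adjoin.powerBasis_gen]
      exact h.trans (congrArg Complex.ofReal (coe_gen β).symm)
    have h4 : v.embedding = (algebraMap ℝ ℂ).comp (algebraMap (K β) ℝ) :=
      RingHom.ext fun x => DFunLike.congr_fun h3 x
    rw [idPlace, ← h4, InfinitePlace.mk_embedding]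

lemma adicAbv_gen_lt_one (P : PrimesOver β) : adicAbv (K β) P.1 (gen β) < 1 := by
  rw [← norm_algebraMap_adic]
  exact (FinitePlace.norm_lt_one_iff_mem (K β) P.1 (intGen β)).2
    ((mem_primesOver_iff β P.1).1 P.2)

lemma norm_phi_gen_lt_one : ‖phi β (gen β)‖ < 1 := by
  rw [Prod.norm_def, max_lt_iff, pi_norm_lt_iff one_pos, pi_norm_lt_iff one_pos]
  refine ⟨fun v => ?_, fun P => ?_⟩
  · rw [show (phi β (gen β)).1 v = algebraMap (K β) v.1.Completion (gen β) from rfl,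
      InfinitePlace.Completion.algebraMap_apply, InfinitePlace.Completion.norm_coe]
    exact place_gen_lt_one β v.2
  · refine lt_of_eq_of_lt ?_ (adicAbv_gen_lt_one β P)
    rw [← norm_algebraMap_adic]
    rfl

/-! ### Discreteness -/

/-- The ring `ℤ[1/β]` as a subring of `ℚ(β)`. -/
def zInvK : Subring (K β) := (zInv β).comap (algebraMap (K β) ℝ)

omit hP in
lemma mem_zInvK {u : K β} : u ∈ zInvK β ↔ (u : ℝ) ∈ zInv β := Iff.rfl

lemma gen_mem : gen β ∈ zInvK β := by
  rw [mem_zInvK, coe_gen]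
  exact mem_zInv (by linarith [hP.out.one_lt]) hP.out.isIntegral

omit hP in
lemma inv_gen_mem : (gen β)⁻¹ ∈ zInvK β := by
  rw [mem_zInvK]
  push_cast
  rw [coe_gen]
  exact inv_mem_zInv

end Instances

section Arithmetic

open NumberField NumberField.HeightOneSpectrum

variable (β : ℝ) [hP : Fact (IsPisot β)]

attribute [local instance] fintypePrimesOver fintypePlaces normedCommRing properSpace

omit hP in
lemma zInvK_le {S : Subring (K β)} (h : (gen β)⁻¹ ∈ S) : zInvK β ≤ S := by
  intro u hu
  have hle : Algebra.adjoin ℤ {β⁻¹} ≤ subalgebraOfSubring (S.map (algebraMap (K β) ℝ)) := by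
    rw [Algebra.adjoin_le_iff, Set.singleton_subset_iff]
    refine ⟨_, h, ?_⟩
    rw [map_inv₀]
    exact congrArg _ (coe_gen β)
  obtain ⟨v, hv, e⟩ := hle hu
  rwa [← (algebraMap (K β) ℝ).injective e]

lemma valuation_le_one_of_mem {u : K β} (hu : u ∈ zInvK β) {P : HeightOneSpectrum (𝓞 (K β))}
    (hP : intGen β ∉ P.asIdeal) : P.valuation (K β) u ≤ 1 := by
  refine zInvK_le β (S := (P.valuation (K β)).integer) ?_ hu
  rw [Valuation.mem_integer_iff, map_inv₀]
  have : P.valuation (K β) (gen β) = 1 :=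
    (P.valuation_eq_one_iff_notMem (K := K β) (r := intGen β)).2 hP
  rw [this, inv_one]

/-- The norm controls the primes containing `β`; at all others `β` is a unit. Integrality reduces
discreteness to the finiteness of algebraic integers with bounded conjugates. -/
lemma isIntegral_of_norm_phi_le {u : K β} (hu : u ∈ zInvK β) (h : ‖phi β u‖ ≤ 1) :
    IsIntegral ℤ u := by
  obtain ⟨r, hr⟩ := HeightOneSpectrum.mem_integers_of_valuation_le_one (R := 𝓞 (K β)) (K β) u
    fun P => by
      by_cases hP : intGen β ∈ P.asIdeal
      · rw [← adicAbv_le_one_iff]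
        exact ((norm_phi_le_iff β zero_le_one).1 h).2 ⟨P, (mem_primesOver_iff β P).2 hP⟩
      · exact valuation_le_one_of_mem β hu hP
  rw [← hr]
  exact r.2

omit hP in
lemma idPlace_apply (u : K β) : idPlace β u = |(u : ℝ)| := by
  rw [idPlace, InfinitePlace.apply]
  exact Complex.norm_real _

lemma finite_of_norm_phi_le_one (M : ℝ) :
    {u : K β | u ∈ zInvK β ∧ |(u : ℝ)| ≤ M ∧ ‖phi β u‖ ≤ 1}.Finite := by
  refine (Embeddings.finite_of_norm_le (K β) ℂ (max M 1)).subset ?_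
  rintro u ⟨hu, hM, h1⟩
  refine ⟨isIntegral_of_norm_phi_le β hu h1, fun σ => ?_⟩
  rw [← InfinitePlace.apply]
  by_cases hσ : InfinitePlace.mk σ = idPlace β
  · rw [hσ, idPlace_apply]
    exact hM.trans (le_max_left _ _)
  · exact (((norm_phi_le_iff β zero_le_one).1 h1).1 _ hσ).trans (le_max_right _ _)

/-- `ℤ[1/β]` is discrete in `K_β × ℝ`. -/
lemma finite_of_norm_phi_le (M C : ℝ) :
    {u : K β | u ∈ zInvK β ∧ |(u : ℝ)| ≤ M ∧ ‖phi β u‖ ≤ C}.Finite := by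
  -- A power of `β` moves the images into the unit ball and enlarges only the real bound. The
  -- exponent is positive because `‖1‖ = 1` is not used.
  obtain ⟨k, hk⟩ : ∃ k : ℕ, ‖phi β (gen β)‖ ^ (k + 1) * |C| ≤ 1 := by
    have := ((tendsto_pow_atTop_nhds_zero_of_lt_one (norm_nonneg _)
      (norm_phi_gen_lt_one β)).mul_const |C|).comp (Filter.tendsto_add_atTop_nat 1)
    rw [zero_mul] at this
    exact (this.eventually (ge_mem_nhds one_pos)).exists
  have hinj : Function.Injective fun u : K β => gen β ^ (k + 1) * u :=
    mul_right_injective₀ (pow_ne_zero _ (gen_ne_zero β))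
  refine ((finite_of_norm_phi_le_one β (β ^ (k + 1) * M)).preimage hinj.injOn).subset ?_
  rintro u ⟨hu, hM, hC⟩
  have hβ := hP.out.one_lt
  refine ⟨mul_mem (pow_mem (gen_mem β) _) hu, ?_, ?_⟩
  · push_cast
    rw [coe_gen, abs_mul, abs_of_pos (by positivity)]
    gcongr
  · rw [map_mul, map_pow]
    refine (norm_mul_le _ _).trans (le_trans ?_ hk)
    exact mul_le_mul (norm_pow_le' _ (Nat.succ_pos k)) (hC.trans (le_abs_self C)) (norm_nonneg _)
      (by positivity)

/-! ### Density -/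

/-- Weak approximation. The element `2` separates archimedean from finite places, and two primes are
separated by an integer in only one of them. -/
lemma denseRange_phi : DenseRange (phi β) := by
  let ι := {v : InfinitePlace (K β) // v ≠ idPlace β} ⊕ PrimesOver β
  let w : ι → AbsoluteValue (K β) ℝ := Sum.elim (fun v => v.1.1) (fun P => adicAbv (K β) P.1)
  have harch : ∀ v : InfinitePlace (K β), 1 < v.1 (2 : K β) := fun v => by
    have := v.map_natCast 2
    rw [InfinitePlace.coe_apply] at this
    push_cast at this
    rw [this]
    norm_num
  have hna : ∀ P : HeightOneSpectrum (𝓞 (K β)), ¬ 1 < adicAbv (K β) P (2 : K β) := fun P => by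
    rw [not_lt]
    exact_mod_cast adicAbv_natCast_le_one (K β) P 2
  have hnt : ∀ i, (w i).IsNontrivial := by
    rintro (v | P)
    · exact v.1.isNontrivial
    · refine ⟨gen β, gen_ne_zero β, (adicAbv_gen_lt_one β P).ne⟩
  have hpw : Pairwise fun i j => ¬ (w i).IsEquiv (w j) := by
    rintro (v | P) (v' | P') hne he
    · exact hne (congrArg _ (Subtype.ext (InfinitePlace.eq_iff_isEquiv.2 he)))
    · exact hna P'.1 (he.one_lt_iff.1 (harch v.1))
    · exact hna P.1 (he.one_lt_iff.2 (harch v'.1))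
    · refine hne (congrArg _ (Subtype.ext ?_))
      by_contra hPP
      obtain ⟨x, hx1, hx2⟩ : ∃ x : 𝓞 (K β), x ∈ P.1.asIdeal ∧ x ∉ P'.1.asIdeal := by
        by_contra! H
        exact hPP (HeightOneSpectrum.ext (P.1.isMaximal.eq_of_le Ideal.IsPrime.ne_top' H))
      have h1 := (FinitePlace.norm_lt_one_iff_mem (K β) P.1 x).2 hx1
      have h2 := (FinitePlace.norm_eq_one_iff_notMem (K β) P'.1 x).2 hx2
      rw [FinitePlace.norm_embedding] at h1 h2
      exact (he.lt_one_iff.1 h1).ne h2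
  have hd := AbsoluteValue.denseRange_algebraMap_pi hnt hpw
  rw [Metric.denseRange_iff]
  intro z ε hε
  -- The approximation theorem concerns tuples in the field itself, so each coordinate of `z` is
  -- first approximated there.
  have h1 : ∀ v : {v : InfinitePlace (K β) // v ≠ idPlace β}, ∃ k : K β,
      ‖z.1 v - algebraMap (K β) v.1.Completion k‖ < ε / 2 := fun v => by
    obtain ⟨k, hk⟩ := (InfinitePlace.Completion.denseRange_coe v.1).exists_dist_lt (z.1 v)
      (half_pos hε)
    exact ⟨WithAbs.equiv v.1.1 k, by rwa [dist_eq_norm] at hk⟩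
  have h2 : ∀ P : PrimesOver β, ∃ k : K β,
      ‖z.2 P - algebraMap (K β) (P.1.adicCompletion (K β)) k‖ < ε / 2 := fun P => by
    obtain ⟨k, hk⟩ := (HeightOneSpectrum.denseRange_algebraMap (K β) P.1).exists_dist_lt (z.2 P)
      (half_pos hε)
    exact ⟨k, by rwa [dist_eq_norm] at hk⟩
  choose k₁ hk₁ using h1
  choose k₂ hk₂ using h2
  have : Fintype ι := inferInstance
  obtain ⟨x, hx⟩ := hd.exists_dist_lt
    (fun i => (WithAbs.equiv (w i)).symm (Sum.rec (motive := fun _ => K β) k₁ k₂ i)) (half_pos hε)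
  rw [dist_pi_lt_iff (half_pos hε)] at hx
  refine ⟨x, ?_⟩
  rw [dist_eq_norm, Prod.norm_def, max_lt_iff, pi_norm_lt_iff hε, pi_norm_lt_iff hε]
  constructor
  · intro v
    have h3 := hx (Sum.inl v)
    rw [dist_eq_norm] at h3
    have h4 : v.1 (k₁ v - x) < ε / 2 := h3
    have e : (z - phi β x).1 v = (z.1 v - algebraMap (K β) v.1.Completion (k₁ v)) +
        algebraMap (K β) v.1.Completion (k₁ v - x) := by
      rw [map_sub, sub_add_sub_cancel]
      rfl
    rw [e]
    refine (norm_add_le _ _).trans_lt ?_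
    rw [InfinitePlace.Completion.algebraMap_apply v.1 (k₁ v - x),
      InfinitePlace.Completion.norm_coe]
    have h5 := hk₁ v
    change _ + v.1 (k₁ v - x) < _
    linarith
  · intro P
    have h3 := hx (Sum.inr P)
    rw [dist_eq_norm] at h3
    have h4 : adicAbv (K β) P.1 (k₂ P - x) < ε / 2 := h3
    have e : (z - phi β x).2 P = (z.2 P - algebraMap (K β) (P.1.adicCompletion (K β)) (k₂ P)) +
        algebraMap (K β) (P.1.adicCompletion (K β)) (k₂ P - x) := by
      rw [map_sub, sub_add_sub_cancel]
      rfl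
    rw [e]
    refine (norm_add_le _ _).trans_lt ?_
    rw [norm_algebraMap_adic]
    have h5 := hk₂ P
    linarith

/-- The ring `ℤ[β]`. -/
abbrev zGen : Subalgebra ℤ (K β) := Algebra.adjoin ℤ {gen β}

lemma zGen_le {u : K β} (hu : u ∈ zGen β) : u ∈ zInvK β := by
  have hle : zGen β ≤ subalgebraOfSubring (zInvK β) := by
    rw [Algebra.adjoin_le_iff, Set.singleton_subset_iff]
    exact gen_mem β
  exact hle hu

/-- Pigeonhole: the powers of `β` are eventually periodic in the finite ring `ℤ[β]/d`. -/
lemma exists_pow_sub_pow (d : ℕ) (hd : d ≠ 0) : ∃ i q : ℕ, 0 < q ∧ ∀ m : ℕ,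
    ∃ u ∈ zInvK β, gen β ^ i - gen β ^ (i + m * q) = d * u := by
  have hfm : Module.Finite ℤ (zGen β) :=
    Module.Finite.iff_fg.2 (isIntegral_gen β).fg_adjoin_singleton
  have hfree : Module.Free ℤ (zGen β) := Module.free_of_finite_type_torsion_free'
  have hfin : Finite (zGen β ⧸ Ideal.span {(d : zGen β)}) :=
    Ideal.finiteQuotientOfFreeOfNeBot _ (by simpa using hd)
  let g : zGen β := ⟨gen β, Algebra.subset_adjoin rfl⟩
  let G := Ideal.Quotient.mk (Ideal.span {(d : zGen β)}) g
  obtain ⟨i, j, hlt, hij⟩ : ∃ i j : ℕ, i < j ∧ G ^ i = G ^ j := by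
    obtain ⟨i, j, hne, hij⟩ := Finite.exists_ne_map_eq_of_infinite fun i : ℕ => G ^ i
    rcases lt_or_gt_of_ne hne with h | h
    · exact ⟨i, j, h, hij⟩
    · exact ⟨j, i, h, hij.symm⟩
  refine ⟨i, j - i, by omega, fun m => ?_⟩
  have hm : G ^ (i + m * (j - i)) = G ^ i := by
    induction m with
    | zero => simp
    | succ m ih =>
      have : i + (m + 1) * (j - i) = j + m * (j - i) := by
        rw [add_mul, one_mul]
        omega
      rw [this, pow_add, ← hij, ← pow_add, ih]
  have hmem : g ^ i - g ^ (i + m * (j - i)) ∈ Ideal.span {(d : zGen β)} := by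
    rw [← Ideal.Quotient.eq, map_pow, map_pow]
    exact hm.symm
  obtain ⟨r, hr⟩ := Ideal.mem_span_singleton'.1 hmem
  refine ⟨r, zGen_le β r.2, ?_⟩
  have := congrArg (algebraMap (zGen β) (K β)) hr
  rw [map_mul, map_sub, map_pow, map_pow, map_natCast] at this
  exact this.symm.trans (mul_comm _ _)

lemma tendsto_phi_gen_pow :
    Filter.Tendsto (fun k : ℕ => phi β (gen β ^ k)) Filter.atTop (nhds 0) := by
  simp only [map_pow]
  exact tendsto_pow_atTop_nhds_zero_of_norm_lt_one (norm_phi_gen_lt_one β)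

/-- The elements `(1 - β^(mq))/d` lie in ℤ[1/β] by the preceding congruence, and their images tend
to that of `1/d`. -/
lemma inv_natCast_mem_closure (d : ℕ) :
    phi β (d : K β)⁻¹ ∈ ((zInvK β).map (phi β)).topologicalClosure := by
  rcases eq_or_ne d 0 with rfl | hd
  · simp
  obtain ⟨i, q, hq, h⟩ := exists_pow_sub_pow β d hd
  have hd' : (d : K β) ≠ 0 := Nat.cast_ne_zero.2 hd
  have hg := gen_ne_zero β
  choose u hu hm using h
  have e : ∀ m, phi β ((gen β)⁻¹ ^ i * u m) =
      phi β (d : K β)⁻¹ - phi β (d : K β)⁻¹ * phi β (gen β ^ (m * q)) := by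
    intro m
    rw [← map_mul, ← map_sub]
    congr 1
    have h1 : u m = (gen β ^ i - gen β ^ (i + m * q)) * (d : K β)⁻¹ := by
      rw [hm]
      field_simp
    rw [h1, pow_add, inv_pow]
    field_simp
  have hlim : Filter.Tendsto (fun m : ℕ => phi β ((gen β)⁻¹ ^ i * u m)) Filter.atTop
      (nhds (phi β (d : K β)⁻¹)) := by
    simp only [e]
    have h2 : Filter.Tendsto (fun m : ℕ => m * q) Filter.atTop Filter.atTop :=
      Filter.tendsto_id.atTop_mul_const' hq
    have := tendsto_const_nhds (x := phi β (d : K β)⁻¹) |>.sub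
      (((tendsto_phi_gen_pow β).comp h2).const_mul (phi β (d : K β)⁻¹))
    simpa using this
  exact mem_closure_of_tendsto hlim (Filter.Eventually.of_forall fun m =>
    ⟨_, mul_mem (pow_mem (inv_gen_mem β) i) (hu m), rfl⟩)

lemma phi_mem_closure (u : K β) :
    phi β u ∈ ((zInvK β).map (phi β)).topologicalClosure := by
  set H := ((zInvK β).map (phi β)).topologicalClosure
  have hint : IsIntegral ℚ β := hP.out.isIntegral.tower_top
  have hgen : phi β (gen β) ∈ H := Subring.le_topologicalClosure _ ⟨_, gen_mem β, rfl⟩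
  have hrat : ∀ q : ℚ, phi β (algebraMap ℚ (K β) q) ∈ H := fun q => by
    have e : algebraMap ℚ (K β) q = (q.num : K β) * (q.den : K β)⁻¹ := by
      conv_lhs => rw [← Rat.num_div_den q]
      rw [div_eq_mul_inv, map_mul, map_inv₀, map_intCast, map_natCast]
    rw [e, map_mul, map_intCast]
    exact mul_mem (intCast_mem _ _) (inv_natCast_mem_closure β _)
  obtain ⟨f, rfl⟩ := (adjoin.powerBasis hint).exists_eq_aeval' u
  rw [adjoin.powerBasis_gen, Polynomial.aeval_eq_sum_range, map_sum]
  refine sum_mem fun i _ => ?_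
  rw [Algebra.smul_def, map_mul, map_pow]
  exact mul_mem (hrat _) (pow_mem hgen _)

/-- The non-negative elements of `ℤ[1/β]`. -/
def zInvNonneg : Set (K β) := {u | u ∈ zInvK β ∧ 0 ≤ (u : ℝ)}

/-- Adding a high power of `β` makes an element non-negative while hardly moving its image. -/
lemma dense_phi_zInvNonneg : Dense (phi β '' zInvNonneg β) := by
  have h1 : Dense ((phi β) '' (zInvK β : Set (K β))) := by
    rw [dense_iff_closure_eq, ← Set.univ_subset_iff, ← (denseRange_phi β).closure_range]
    refine closure_minimal ?_ isClosed_closure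
    rintro _ ⟨u, rfl⟩
    exact phi_mem_closure β u
  refine h1.mono ?_ |>.of_closure
  rintro _ ⟨u, hu, rfl⟩
  have hlim : Filter.Tendsto (fun k : ℕ => phi β (u + gen β ^ k)) Filter.atTop
      (nhds (phi β u)) := by
    simp only [map_add]
    simpa using (tendsto_phi_gen_pow β).const_add (phi β u)
  refine mem_closure_of_tendsto hlim ?_
  filter_upwards [(tendsto_pow_atTop_atTop_of_one_lt hP.out.one_lt).eventually_ge_atTop (-(u : ℝ))]
    with k hk
  refine ⟨_, ⟨add_mem hu (pow_mem (gen_mem β) k), ?_⟩, rfl⟩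
  push_cast
  rw [coe_gen]
  linarith

end Arithmetic

/-! ### Porous sets are null sets -/

section Porous

variable {E : Type*} [NormedCommRing E] [ProperSpace E] [MeasurableSpace E] [BorelSpace E]
  (μ : Measure E) [μ.IsAddHaarMeasure]

/-- Multiplication by a unit scales Haar measure. -/
lemma exists_measure_unit_mul (b : Eˣ) : ∃ c : ENNReal, c ≠ 0 ∧ c ≠ ⊤ ∧
    ∀ S : Set E, μ {z | ↑b⁻¹ * z ∈ S} = c * μ S := by
  let e : E ≃ₜ+ E := ⟨AddEquiv.mk' b⁻¹.mulLeft (mul_add _), continuous_const_mul _,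
    continuous_const_mul _⟩
  have : (μ.map e).IsAddHaarMeasure := e.isAddHaarMeasure_map μ
  have h : μ.map e = (μ.map e).addHaarScalarFactor μ • μ :=
    Measure.isAddLeftInvariant_eq_smul (μ.map e) μ
  refine ⟨(μ.map e).addHaarScalarFactor μ, ?_, ENNReal.coe_ne_top, fun S => ?_⟩
  · exact ENNReal.coe_ne_zero.2 (Measure.addHaarScalarFactor_pos_of_isAddHaarMeasure _ _).ne'
  · have h1 : μ.map e S = μ {z | ↑b⁻¹ * z ∈ S} := e.toHomeomorph.toMeasurableEquiv.map_apply S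
    rw [← h1]
    exact DFunLike.congr_fun h S

/-- A double count in place of a density theorem. At a small scale `g = b^(k+1)`, each point of a
compact part `F` of `N` sees a hole of measure `c · mB` nearby, while each point outside `N` is seen
from a set of measure at most `c · mA`. This contradicts the choice of an open `O ⊇ F` with `μ (O \
F)` small. -/
lemma measure_eq_zero_of_porous {b : Eˣ} (hb : ‖(b : E)‖ < 1) {N : Set E} (hN : IsClosed N)
    (hinv : ∀ z ∉ N, (b : E) * z ∉ N) {X : Set E} {ρ : ℝ} (hρ : 0 < ρ)
    (hX : ∀ x ∈ X, Disjoint (Metric.ball x ρ) N) {C : ℝ} (hC : ∀ w, ∃ x ∈ X, dist w x ≤ C) :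
    μ N = 0 := by
  by_contra hne
  obtain ⟨n, hn⟩ : ∃ n : ℕ, μ (N ∩ Metric.closedBall 0 n) ≠ 0 := by
    by_contra! h
    refine hne (measure_mono_null ?_ (measure_iUnion_null h))
    intro z hz
    obtain ⟨n, hn⟩ := exists_nat_ge ‖z‖
    exact Set.mem_iUnion.2 ⟨n, hz, by simpa using hn⟩
  set F := N ∩ Metric.closedBall 0 (n : ℝ)
  have hF : IsCompact F := (isCompact_closedBall _ _).inter_left hN
  have hFtop : μ F ≠ ⊤ := hF.measure_lt_top.ne
  -- The ball of radius `R` around any point contains a ball of radius `ρ` around some `x ∈ X`.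
  set R := |C| + ρ
  have hR : 0 < R := by positivity
  set mB := μ (Metric.ball 0 ρ) with hmB
  set mA := μ (Metric.closedBall 0 R) with hmA
  have hmB0 : mB ≠ 0 := (Metric.measure_ball_pos μ 0 hρ).ne'
  have hmBtop : mB ≠ ⊤ := measure_ball_lt_top.ne
  have hmA0 : mA ≠ 0 := (Metric.measure_closedBall_pos μ 0 hR).ne'
  have hmAtop : mA ≠ ⊤ := measure_closedBall_lt_top.ne
  have hε : μ F * mB / mA ≠ 0 := by
    simp [ENNReal.div_eq_zero_iff, hn, hmB0, hmAtop]
  obtain ⟨O, hFO, hO, hlt⟩ := F.exists_isOpen_lt_add hFtop hε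
  obtain ⟨δ, hδ, hthick⟩ := hF.exists_thickening_subset_open hO hFO
  obtain ⟨k, hk⟩ : ∃ k : ℕ, ‖(b : E)‖ ^ (k + 1) * R < δ := by
    have := ((tendsto_pow_atTop_nhds_zero_of_lt_one (norm_nonneg _) hb).mul_const R).comp
      (Filter.tendsto_add_atTop_nat 1)
    rw [zero_mul] at this
    exact (this.eventually (gt_mem_nhds hδ)).exists
  set g : Eˣ := b ^ (k + 1) with hg
  have hginv : ∀ z ∉ N, (g : E) * z ∉ N := by
    rw [hg]
    generalize k + 1 = j
    induction j with
    | zero => simp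
    | succ j ih =>
      intro z hz
      rw [pow_succ', Units.val_mul, mul_assoc]
      exact hinv _ (ih z hz)
  obtain ⟨c, hc0, hctop, hc⟩ := exists_measure_unit_mul μ g
  let Q : Set (E × E) :=
    {q | q.1 ∈ F ∧ q.2 ∈ O \ N ∧ (↑g⁻¹ : E) * (q.2 - q.1) ∈ Metric.closedBall 0 R}
  have hQ : MeasurableSet Q := by
    refine (hF.measurableSet.preimage measurable_fst).inter
      (((hO.measurableSet.diff hN.measurableSet).preimage measurable_snd).inter ?_)
    exact (Metric.isClosed_closedBall.preimage (by fun_prop)).measurableSet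
  have lower : ∀ z ∈ F, c * mB ≤ μ (Prod.mk z ⁻¹' Q) := by
    intro z hz
    obtain ⟨x, hxX, hx⟩ := hC (↑g⁻¹ * z)
    have e : c * mB = μ {p | ↑g⁻¹ * p ∈ Metric.ball x ρ} := by
      rw [hc, hmB, Measure.addHaar_ball_center μ x]
    rw [e]
    refine measure_mono fun p hp => ?_
    have hp' : ↑g⁻¹ * p ∉ N := fun h => Set.disjoint_left.1 (hX x hxX) hp h
    have hpN : p ∉ N := by
      have := hginv _ hp'
      rwa [Units.mul_inv_cancel_left] at this
    have hpR : (↑g⁻¹ : E) * (p - z) ∈ Metric.closedBall 0 R := by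
      rw [mem_closedBall_zero_iff, mul_sub, ← dist_eq_norm]
      have h1 := dist_triangle (↑g⁻¹ * p) x (↑g⁻¹ * z)
      rw [dist_comm x] at h1
      have h2 : dist (↑g⁻¹ * p) x < ρ := hp
      have := le_abs_self C
      linarith
    refine ⟨hz, ⟨hthick ?_, hpN⟩, hpR⟩
    rw [Metric.mem_thickening_iff]
    refine ⟨z, hz, ?_⟩
    rw [mem_closedBall_zero_iff] at hpR
    have e2 : p - z = g * (↑g⁻¹ * (p - z)) := (Units.mul_inv_cancel_left _ _).symm
    rw [dist_eq_norm, e2]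
    refine (norm_mul_le _ _).trans_lt (lt_of_le_of_lt ?_ hk)
    refine mul_le_mul ?_ hpR (norm_nonneg _) (by positivity)
    rw [hg, Units.val_pow_eq_pow_val]
    exact norm_pow_le' _ (Nat.succ_pos k)
  have upper : ∀ p, μ ((fun z => (z, p)) ⁻¹' Q) ≤ (O \ N).indicator (fun _ => c * mA) p := by
    intro p
    by_cases hp : p ∈ O \ N
    · rw [Set.indicator_of_mem hp]
      have e : c * mA = μ ((fun z => p - z) ⁻¹' {z | ↑g⁻¹ * z ∈ Metric.closedBall 0 R}) := by
        rw [(Measure.measurePreserving_sub_left μ p).measure_preimage, hc]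
        exact (Metric.isClosed_closedBall.preimage
          (by fun_prop : Continuous fun z : E => ↑g⁻¹ * z)).measurableSet.nullMeasurableSet
      rw [e]
      exact measure_mono fun z hz => hz.2.2
    · rw [Set.indicator_of_notMem hp, nonpos_iff_eq_zero]
      refine measure_mono_null (fun z hz => ?_) measure_empty
      exact hp hz.2.1
  have h1 : μ F * (c * mB) ≤ (μ.prod μ) Q := by
    rw [Measure.prod_apply hQ, mul_comm, ← setLIntegral_const]
    exact (setLIntegral_mono' hF.measurableSet lower).trans (setLIntegral_le_lintegral _ _)
  have h2 : (μ.prod μ) Q ≤ (c * mA) * μ (O \ N) := by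
    rw [Measure.prod_apply_symm hQ, ← lintegral_indicator_const
      (hO.measurableSet.diff hN.measurableSet)]
    exact lintegral_mono upper
  have h3 : μ (O \ N) < μ F * mB / mA := by
    refine (measure_mono (Set.sdiff_subset_sdiff_right
      (Set.inter_subset_left : F ⊆ N))).trans_lt ?_
    rw [measure_sdiff hFO hF.measurableSet.nullMeasurableSet hFtop]
    exact ENNReal.sub_lt_of_lt_add (measure_mono hFO) (by rwa [add_comm])
  have h4 : (c * mA) * μ (O \ N) < (c * mA) * (μ F * mB / mA) :=
    ENNReal.mul_lt_mul_right (mul_ne_zero hc0 hmA0) (ENNReal.mul_ne_top hctop hmAtop) h3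
  have h5 : (c * mA) * (μ F * mB / mA) = μ F * (c * mB) := by
    rw [mul_assoc, ENNReal.mul_div_cancel hmA0 hmAtop]
    ring
  exact absurd ((h1.trans h2).trans_lt h4) (by rw [h5]; exact lt_irrefl _)

end Porous

/-! ### Neighbourhoods of the points of `φ_β(ℤ[1/β])` -/

section Local

variable (β : ℝ) [hP : Fact (IsPisot β)]

attribute [local instance] fintypePrimesOver fintypePlaces normedCommRing properSpace

/-- Only `K_β ≠ 0` needs proof: otherwise discreteness would make ℤ[1/β] ∩ [0,1] finite, although it
contains all `β^(-k)`. -/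
lemma phi_injective : Function.Injective (phi β) := by
  have : Nontrivial (KBeta β) := by
    by_contra hsub
    rw [not_nontrivial_iff_subsingleton] at hsub
    have hβ := hP.out.one_lt
    have hfin := finite_of_norm_phi_le β 1 0
    have hinj : Function.Injective fun k : ℕ => (gen β)⁻¹ ^ k := by
      intro i j hij
      have h1 := congrArg (algebraMap (K β) ℝ) hij
      simp only [map_pow, map_inv₀] at h1
      rw [show algebraMap (K β) ℝ (gen β) = β from coe_gen β, inv_pow, inv_pow] at h1
      exact pow_right_injective₀ (by linarith) hβ.ne' (inv_injective h1)
    refine Set.infinite_range_of_injective hinj (hfin.subset ?_)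
    rintro _ ⟨k, rfl⟩
    refine ⟨pow_mem (inv_gen_mem β) k, ?_, by simp [Subsingleton.elim (phi β _) 0]⟩
    push_cast
    rw [coe_gen, abs_of_pos (by positivity)]
    exact pow_le_one₀ (by positivity) (inv_le_one_of_one_le₀ hβ.le)
  exact (phi β).injective

variable {β}
variable (hF : FinitenessProperty β)
include hF

/-- The images of the `β`-integers are bounded. -/
lemma exists_norm_phi_subInt_le : ∃ C : ℝ, 0 ≤ C ∧ ∀ a, ∀ y ∈ subInt β a,
    ∃ y' : K β, (y' : ℝ) = y ∧ y' ∈ zInvK β ∧ ‖phi β y'‖ ≤ C := by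
  have hβ := hP.out.one_lt
  have hfin := hasFiniteExpansion_one hP.out hF
  have hρ := norm_phi_gen_lt_one β
  set ρ := ‖phi β (gen β)‖
  have hρ' : 0 < 1 - ρ := by linarith
  -- The fixed point of `C ↦ Cρ + β‖1‖`, which bounds one Horner step with a digit below `β`.
  set C := β * ‖(1 : KBeta β)‖ / (1 - ρ) with hC
  have hC0 : 0 ≤ C := by positivity
  have hCρ : C * ρ + β * ‖(1 : KBeta β)‖ = C := by
    rw [hC]
    field_simp
    ring
  refine ⟨C, hC0, fun a y hy => subInt_induction hβ hfin
    (p := fun y => ∃ y' : K β, (y' : ℝ) = y ∧ y' ∈ zInvK β ∧ ‖phi β y'‖ ≤ C) ?_ ?_ hy⟩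
  · exact ⟨0, by simp, zero_mem _, by simpa using hC0⟩
  · rintro v ⟨v', rfl, hv, hvC⟩ ε hε
    refine ⟨v' * gen β + ε, ?_, add_mem (mul_mem hv (gen_mem β)) (natCast_mem _ _), ?_⟩
    · push_cast
      rw [coe_gen]
    · rw [map_add, map_mul, map_natCast, ← hCρ]
      refine (norm_add_le _ _).trans (add_le_add ((norm_mul_le _ _).trans ?_)
        ((Nat.norm_cast_le ε).trans ?_))
      · exact mul_le_mul_of_nonneg_right hvC (norm_nonneg _)
      · exact mul_le_mul_of_nonneg_right hε.le (norm_nonneg _)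

/-- The decomposition into integer part and fractional part, in `ℚ(β)`. -/
lemma exists_decomposition_K : ∃ C : ℝ, 0 ≤ C ∧ ∀ u ∈ zInvNonneg β,
    ∃ (a : ℕ) (y x : K β), 1 ≤ a ∧ a ≤ expLength β ∧ (y : ℝ) ∈ subInt β a ∧ x ∈ tileIndex β ∧ u = y + x ∧
      (x : ℝ) = betaFract β u ∧ (x : ℝ) < quasiOrbit β (a - 1) ∧ ‖phi β y‖ ≤ C := by
  have hβ := hP.out.one_lt
  have hfin := hasFiniteExpansion_one hP.out hF
  obtain ⟨C, hC0, hC⟩ := exists_norm_phi_subInt_le hF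
  refine ⟨C, hC0, fun u hu => ?_⟩
  obtain ⟨a, h1, h2, y, hy, e, h0, hx⟩ := exists_decomposition hβ hfin hu.2
  obtain ⟨y', rfl, hy', hyC⟩ := hC a y hy
  have ex : ((u - y' : K β) : ℝ) = betaFract β u := by
    push_cast
    linarith
  refine ⟨a, y', u - y', h1, h2, hy, ⟨sub_mem hu.1 hy', ?_, ?_⟩, by ring, ex, ?_, hyC⟩
  · rwa [ex]
  · rw [ex]
    exact hx.trans_le (quasiOrbit_mem _).2
  · rwa [ex]

/-- Property (F): the origin is an exclusive inner point of the central tile. -/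
lemma exists_ball_zero : ∃ r > 0, ∀ u ∈ zInvNonneg β, ‖phi β u‖ < r →
    ∃ a, (u : ℝ) ∈ subInt β a := by
  have hβ := hP.out.one_lt
  have hfin := hasFiniteExpansion_one hP.out hF
  obtain ⟨C, hC0, hC⟩ := exists_decomposition_K hF
  have hX := finite_of_norm_phi_le β 1 (1 + C)
  -- Discreteness leaves finitely many `x`, so (F) holds for them with one common length.
  obtain ⟨L, hL⟩ : ∃ L : ℕ, ∀ x ∈ tileIndex β, ‖phi β x‖ ≤ 1 + C →
      ∀ i ≥ L, digit β x i = 0 := by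
    have h1 : ∀ x : K β, ∃ N : ℕ, x ∈ tileIndex β → ∀ i ≥ N, digit β x i = 0 := fun x => by
      by_cases hx : x ∈ tileIndex β
      · obtain ⟨N, hN⟩ := hF x hx.1 hx.2.1 hx.2.2
        exact ⟨N, fun _ => hN⟩
      · exact ⟨0, fun h => absurd h hx⟩
    choose N hN using h1
    obtain ⟨L, hL⟩ := (hX.image N).bddAbove
    refine ⟨L, fun x hx hxC i hi => hN x hx i (le_trans (hL ⟨x, ⟨hx.1, ?_, hxC⟩, rfl⟩) hi)⟩
    rw [abs_of_nonneg hx.2.1]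
    exact hx.2.2.le
  have key : ∀ u ∈ zInvNonneg β, ‖phi β u‖ ≤ 1 → ∃ a, (u : ℝ) * β ^ L ∈ subInt β a := by
    intro u hu h1
    obtain ⟨a, y, x, -, -, -, hx, e, ex, -, hyC⟩ := hC u hu
    refine exists_subInt_of_pow_mul hβ hfin hu.2 ?_
    rw [← ex]
    refine hL x hx ?_
    rw [show x = u - y by rw [e]; ring, map_sub]
    exact (norm_sub_le _ _).trans (add_le_add h1 hyC)
  -- Within this radius `β^(-L) u` has image in the unit ball, and `key` multiplies it back to `u`.
  refine ⟨1 / (‖phi β ((gen β)⁻¹ ^ L)‖ + 1), by positivity, fun u hu hlt => ?_⟩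
  rw [lt_div_iff₀ (by positivity)] at hlt
  have e : (((gen β)⁻¹ ^ L * u : K β) : ℝ) = β⁻¹ ^ L * u := by
    push_cast
    rw [coe_gen]
  obtain ⟨a, ha⟩ := key ((gen β)⁻¹ ^ L * u) ⟨mul_mem (pow_mem (inv_gen_mem β) L) hu.1, by
    rw [e]
    exact mul_nonneg (by positivity) hu.2⟩ (by
      rw [map_mul]
      refine (norm_mul_le _ _).trans ?_
      nlinarith [norm_nonneg (phi β u), norm_nonneg (phi β ((gen β)⁻¹ ^ L))])
  refine ⟨a, ?_⟩
  rw [e] at ha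
  have hβ0 : β ≠ 0 := by linarith
  have e2 : β⁻¹ ^ L * (u : ℝ) * β ^ L = u := by
    rw [inv_pow]
    field_simp
  rwa [e2] at ha

/-- Every point of `φ_β(ℤ[1/β])` near a `β`-integer with node `a`, with preimage bounded below,
comes from a `β`-integer with node `a`. -/
lemma exists_ball_subInt {a : ℕ} {y : K β} (hy : (y : ℝ) ∈ subInt β a) (M : ℝ) :
    ∃ r > 0, ∀ u ∈ zInvK β, -M ≤ (u : ℝ) → ‖phi β u - phi β y‖ < r →
      (u : ℝ) ∈ subInt β a := by
  have hβ := hP.out.one_lt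
  have hβ0 : β ≠ 0 := by linarith
  have hfin := hasFiniteExpansion_one hP.out hF
  have hyK : y ∈ zInvK β :=
    subInt_subset_zInv hβ hfin (mem_zInv (by linarith) hP.out.isIntegral) hy
  obtain ⟨r₀, hr₀, h0⟩ := exists_ball_zero hF
  obtain ⟨k, hk⟩ := exists_add_mem_subInt hβ hfin hy
  -- Only finitely many `u` in `[-M, y)` have image within `1` of `φ(y)`, and by injectivity none
  -- hits `φ(y)`. A small radius thus forces `u ≥ y`.
  obtain ⟨r₂, hr₂, h2⟩ : ∃ r > 0, ∀ u ∈ zInvK β, -M ≤ (u : ℝ) → (u : ℝ) < y →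
      ‖phi β u - phi β y‖ < r → 1 ≤ ‖phi β u - phi β y‖ := by
    have hW := ((finite_of_norm_phi_le β (max M y) (‖phi β y‖ + 1)).sdiff
      (t := {y})).image (phi β)
    have hmem : phi β y ∈ ((phi β) '' ({u | u ∈ zInvK β ∧ |(u : ℝ)| ≤ max M y ∧
        ‖phi β u‖ ≤ ‖phi β y‖ + 1} \ {y}))ᶜ := by
      rintro ⟨u, hu, e⟩
      exact hu.2 (phi_injective β e)
    obtain ⟨r, hr, hball⟩ := Metric.mem_nhds_iff.1 (hW.isClosed.isOpen_compl.mem_nhds hmem)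
    refine ⟨r, hr, fun u hu hM hlt hn => ?_⟩
    by_contra! h1
    refine hball (show phi β u ∈ Metric.ball (phi β y) r by rwa [Metric.mem_ball, dist_eq_norm])
      ⟨u, ⟨⟨hu, ?_, ?_⟩, fun h => ?_⟩, rfl⟩
    · rw [abs_le]
      exact ⟨(neg_le_neg (le_max_left M (y : ℝ))).trans hM, hlt.le.trans (le_max_right _ _)⟩
    · have := norm_add_le (phi β y) (phi β u - phi β y)
      rw [add_sub_cancel] at this
      linarith
    · rw [Set.mem_singleton_iff.1 h] at hlt
      exact lt_irrefl _ hlt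
  refine ⟨min (min r₂ 1) (r₀ / (‖phi β ((gen β)⁻¹ ^ k)‖ + 1)), by positivity,
    fun u hu hM hn => ?_⟩
  rw [lt_min_iff, lt_min_iff] at hn
  have hle : (y : ℝ) ≤ u := by
    by_contra! hlt
    linarith [h2 u hu hM hlt hn.1.1, hn.1.2]
  have e : (((gen β)⁻¹ ^ k * (u - y) : K β) : ℝ) = β⁻¹ ^ k * (u - y) := by
    push_cast
    rw [coe_gen]
  obtain ⟨b, hb⟩ := h0 ((gen β)⁻¹ ^ k * (u - y))
    ⟨mul_mem (pow_mem (inv_gen_mem β) k) (sub_mem hu hyK), by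
      rw [e]
      exact mul_nonneg (by positivity) (by linarith)⟩ (by
      have h3 := hn.2
      rw [lt_div_iff₀ (by positivity)] at h3
      rw [map_mul, map_sub]
      refine (norm_mul_le _ _).trans_lt ?_
      nlinarith [norm_nonneg (phi β u - phi β y), norm_nonneg (phi β ((gen β)⁻¹ ^ k))])
  have := hk b _ hb
  rw [e] at this
  have e2 : β⁻¹ ^ k * ((u : ℝ) - y) * β ^ k + y = u := by
    rw [inv_pow]
    field_simp
    ring
  rwa [e2] at this

end Local

/-! ### Families of closures of disjoint sets with a local exclusivity property -/

section Family

variable {ι F E : Type*} [TopologicalSpace E] {φ : F → E} {D : Set F} {S : ι → Set F} {I : Set ι}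

lemma compl_closure_subset (hD : Dense (φ '' D)) (A : Set F) :
    (closure (φ '' (D \ A)))ᶜ ⊆ closure (φ '' A) := by
  intro z hz
  have h1 : z ∈ closure (φ '' (D \ A) ∪ φ '' A) := by
    rw [← Set.image_union, Set.sdiff_union_self]
    exact closure_mono (Set.image_mono Set.subset_union_left) (hD z)
  rw [closure_union] at h1
  exact h1.resolve_left hz

lemma closure_subset_closure_compl {A : Set F}
    (hA : ∀ s ∈ A, φ s ∉ closure (φ '' (D \ A))) :
    closure (φ '' A) ⊆ closure (closure (φ '' (D \ A)))ᶜ := by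
  refine closure_mono ?_
  rintro _ ⟨s, hs, rfl⟩
  exact hA s hs

/-- The complement of the closure of `φ(D \ A)` is open, contains `φ(A)` and, by density, lies in
the closure of `φ(A)`. -/
lemma eq_closure_interior (hD : Dense (φ '' D)) {A : Set F}
    (hA : ∀ s ∈ A, φ s ∉ closure (φ '' (D \ A))) :
    closure (φ '' A) = closure (interior (closure (φ '' A))) := by
  refine subset_antisymm ((closure_subset_closure_compl hA).trans (closure_mono ?_))
    (closure_minimal interior_subset isClosed_closure)
  exact interior_maximal (compl_closure_subset hD A) isClosed_closure.isOpen_compl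

lemma frontier_subset (hD : Dense (φ '' D)) (A : Set F) :
    frontier (closure (φ '' A)) ⊆ closure (φ '' A) ∩ closure (φ '' (D \ A)) := by
  intro z hz
  rw [isClosed_closure.frontier_eq] at hz
  refine ⟨hz.1, ?_⟩
  by_contra h
  exact hz.2 (interior_maximal (compl_closure_subset hD A) isClosed_closure.isOpen_compl h)

lemma closure_subset_of_disjoint {A B : Set F} (hB : B ⊆ D) (h : Disjoint A B) :
    closure (φ '' B) ⊆ closure (φ '' (D \ A)) :=
  closure_mono (Set.image_mono fun _ hb => ⟨hB hb, fun ha => Set.disjoint_left.1 h ha hb⟩)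

/-- Exclusivity is needed for `B` alone: near each point of its closure there are points outside the
closure of `φ(D \ B)`, which contains the closure of `φ(A)`. -/
lemma disjoint_interior {A B : Set F} (hAD : A ⊆ D)
    (hB : ∀ s ∈ B, φ s ∉ closure (φ '' (D \ B))) (h : Disjoint A B) :
    Disjoint (closure (φ '' B)) (interior (closure (φ '' A))) := by
  rw [Set.disjoint_left]
  intro z hzB hzA
  obtain ⟨w, hwA, hwB⟩ := mem_closure_iff.1 (closure_subset_closure_compl hB hzB) _
    isOpen_interior hzA
  exact hwB (closure_subset_of_disjoint hAD h.symm (interior_subset hwA))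

/-- A family whose members avoid the interiors of the other members. -/
lemma family_of_disjoint_interior {T : ι → Set E} (hT : ∀ i ∈ I, IsClosed (T i))
    (h : ∀ i ∈ I, ∀ j ∈ I, i ≠ j → Disjoint (T j) (interior (T i))) [MeasurableSpace E]
    {μ : Measure E} (hμ : ∀ i ∈ I, μ (frontier (T i)) = 0) :
    (∀ i ∈ I, ∀ z ∈ interior (T i), IsExclusive I T i z) ∧
      ∀ i ∈ I, ∀ j ∈ I, i ≠ j →
        Disjoint (T j) (interior (T i)) ∧ μ (T i ∩ T j) = 0 := by
  refine ⟨fun i hi z hz => ⟨interior_subset hz, fun j hj hne hzj =>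
    Set.disjoint_left.1 (h i hi j hj hne.symm) hzj hz⟩, fun i hi j hj hne =>
    ⟨h i hi j hj hne, measure_mono_null (fun z hz => ?_) (hμ i hi)⟩⟩
  rw [(hT i hi).frontier_eq]
  exact ⟨hz.1, Set.disjoint_left.1 (h i hi j hj hne) hz.2⟩

end Family

/-! ### The tiles -/

section Tiles

variable (β : ℝ) [hP : Fact (IsPisot β)]

/-- The elements of `ℚ(β)` whose `β`-fractional part is `x`. -/
def fractSet (x : K β) : Set (K β) := {y | 0 ≤ (y : ℝ) ∧ betaFract β y = x}

/-- The sums of `x` and of a `β`-integer with node `a`. -/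
def nodeSet (p : ℕ × K β) : Set (K β) := {u | ((u - p.2 : K β) : ℝ) ∈ subInt β p.1}

lemma subtileAt_eq (a : ℕ) (x : K β) :
    subtileAt β a x = closure (phi β '' nodeSet β (a, x)) := by
  have h := (Homeomorph.addRight (phi β x)).image_closure (phi β '' {y | (y : ℝ) ∈ subInt β a})
  refine h.trans (congrArg closure ?_)
  ext z
  constructor
  · rintro ⟨_, ⟨y, hy, rfl⟩, rfl⟩
    refine ⟨y + x, ?_, map_add _ _ _⟩
    simpa [nodeSet] using hy
  · rintro ⟨u, hu, rfl⟩
    refine ⟨_, ⟨u - x, hu, rfl⟩, ?_⟩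
    simp

variable {β} (hF : FinitenessProperty β)
include hF

lemma nodeSet_subset {a : ℕ} {x : K β} (hx : x ∈ tileIndex β) :
    nodeSet β (a, x) ⊆ zInvNonneg β := by
  intro u hu
  have hβ := hP.out.one_lt
  have hfin := hasFiniteExpansion_one hP.out hF
  have h1 : u - x ∈ zInvK β :=
    subInt_subset_zInv hβ hfin (mem_zInv (by linarith) hP.out.isIntegral) hu
  have h2 := subInt_nonneg hβ hu
  refine ⟨by simpa using add_mem h1 hx.1, ?_⟩
  push_cast at h2
  linarith [hx.2.1]

lemma notMem_closure_nodeSet {a : ℕ} {x : K β} (hx : x ∈ tileIndex β) (s : K β)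
    (hs : s ∈ nodeSet β (a, x)) :
    phi β s ∉ closure (phi β '' (zInvNonneg β \ nodeSet β (a, x))) := by
  let _ := fintypePrimesOver β
  let _ := fintypePlaces β
  let _ := normedCommRing β
  -- The bound `1` suffices because `u ≥ 0` and `x < 1` give `u - x ≥ -1`.
  obtain ⟨r, hr, h⟩ := exists_ball_subInt hF hs 1
  intro hcl
  obtain ⟨_, ⟨u, hu, rfl⟩, hd⟩ := Metric.mem_closure_iff.1 hcl r hr
  refine hu.2 (h (u - x) (sub_mem hu.1.1 hx.1) ?_ ?_)
  · push_cast
    linarith [hu.1.2, hx.2.2]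
  · rw [map_sub, map_sub, sub_sub_sub_cancel_right, ← dist_eq_norm, dist_comm]
    exact hd

lemma nodeCount_eq' : nodeCount β = expLength β :=
  nodeCount_eq hP.out.one_lt (hasFiniteExpansion_one hP.out hF)

lemma subtileIndex_iff {p : ℕ × K β} : p ∈ subtileIndex β ↔
    1 ≤ p.1 ∧ p.1 ≤ expLength β ∧ p.2 ∈ tileIndex β ∧
      (p.2 : ℝ) < quasiOrbit β (p.1 - 1) := by
  rw [subtileIndex, Set.mem_ofPred_eq, nodeCount_eq' hF]
  refine and_congr_right fun h1 => and_congr_right fun h2 => ?_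
  rw [quasiOrbit_eq_iterate (by omega)]

lemma nodeSet_disjoint {p q : ℕ × K β} (hp : p ∈ subtileIndex β) (hq : q ∈ subtileIndex β)
    (hne : p ≠ q) : Disjoint (nodeSet β p) (nodeSet β q) := by
  rw [subtileIndex_iff hF] at hp hq
  rw [Set.disjoint_left]
  intro u hu hu'
  have := decomposition_unique hP.out.one_lt (hasFiniteExpansion_one hP.out hF) hu hu'
    hp.2.2.1.2.1 hp.2.2.2 hq.2.2.1.2.1 hq.2.2.2 (by push_cast; ring)
  exact hne (Prod.ext this.1 (Subtype.coe_injective this.2))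

lemma nodeSet_disjoint_of_same_node {a : ℕ} {x x' : K β} (hx : x ∈ tileIndex β)
    (hx' : x' ∈ tileIndex β) (hne : x ≠ x') : Disjoint (nodeSet β (a, x)) (nodeSet β (a, x')) := by
  rw [Set.disjoint_left]
  intro u hu hu'
  exact hne (Subtype.coe_injective (subInt_translate_unique hP.out.one_lt
    (hasFiniteExpansion_one hP.out hF) hu hu' hx.2.1 hx.2.2 hx'.2.1 hx'.2.2 (by push_cast; ring)))

lemma nodeSet_subset_fractSet {p : ℕ × K β} (hp : p ∈ subtileIndex β) :
    nodeSet β p ⊆ fractSet β p.2 := by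
  intro u hu
  have hu0 := (nodeSet_subset hF hp.2.2.1 hu).2
  rw [subtileIndex_iff hF] at hp
  refine ⟨hu0, ?_⟩
  have := betaFract_add hP.out.one_lt (hasFiniteExpansion_one hP.out hF) hu hp.2.2.1.2.1 hp.2.2.2
  push_cast at this
  rwa [sub_add_cancel] at this

lemma exists_nodeSet {u : K β} (hu : u ∈ zInvNonneg β) :
    ∃ p ∈ subtileIndex β, u ∈ nodeSet β p ∧ betaFract β u = p.2 := by
  obtain ⟨C, -, hC⟩ := exists_decomposition_K hF
  obtain ⟨a, y, x, h1, h2, hy, hx, rfl, e, hlt, -⟩ := hC u hu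
  refine ⟨(a, x), (subtileIndex_iff hF).2 ⟨h1, h2, hx, hlt⟩, ?_, e.symm⟩
  simpa [nodeSet] using hy

lemma fractSet_subset {x : K β} (hx : x ∈ tileIndex β) : fractSet β x ⊆ zInvNonneg β := by
  intro u hu
  have hβ := hP.out.one_lt
  have hfin := hasFiniteExpansion_one hP.out hF
  refine ⟨?_, hu.1⟩
  obtain ⟨a, -, -, y, hy, e, -, -⟩ := exists_decomposition hβ hfin hu.1
  rw [mem_zInvK, e, hu.2]
  exact add_mem (subInt_subset_zInv hβ hfin (mem_zInv (by linarith) hP.out.isIntegral) hy) hx.1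

/-- Inherited from the piece `nodeSet β (a, x)` that contains `s`. -/
lemma notMem_closure_fractSet {x : K β} (hx : x ∈ tileIndex β) (s : K β)
    (hs : s ∈ fractSet β x) : phi β s ∉ closure (phi β '' (zInvNonneg β \ fractSet β x)) := by
  obtain ⟨p, hp, hsp, e⟩ := exists_nodeSet hF (fractSet_subset hF hx hs)
  have hpx : p.2 = x := Subtype.coe_injective (e.symm.trans hs.2)
  subst hpx
  exact fun h => notMem_closure_nodeSet hF hp.2.2.1 s hsp (closure_mono (Set.image_mono
    (Set.sdiff_subset_sdiff_right (nodeSet_subset_fractSet hF hp))) h)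

omit hP hF in
lemma fractSet_disjoint {x x' : K β} (hne : x ≠ x') : Disjoint (fractSet β x) (fractSet β x') := by
  rw [Set.disjoint_left]
  exact fun u hu hu' => hne (Subtype.coe_injective (hu.2.symm.trans hu'.2))

/-! ### The exceptional null set -/

variable (β) in
/-- The set of points that are not exclusive in the strong sense for any subtile. -/
def exceptionalSet : Set (KBeta β) :=
  ⋂ p ∈ subtileIndex β, closure (phi β '' (zInvNonneg β \ nodeSet β p))

/-- Multiplication by `β` sends the piece `(b, x)` into a piece `(a, T_β x)`. Hence division by `β`
keeps elements of `D` outside the latter piece outside the former. -/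
lemma mul_gen_notMem_exceptionalSet {z : KBeta β} (hz : z ∉ exceptionalSet β) :
    phi β (gen β) * z ∉ exceptionalSet β := by
  have hβ := hP.out.one_lt
  have hfin := hasFiniteExpansion_one hP.out hF
  simp only [exceptionalSet, Set.mem_iInter, not_forall] at hz ⊢
  obtain ⟨p, hp, hz⟩ := hz
  have hp' := (subtileIndex_iff hF).1 hp
  obtain ⟨a, h1, h2, hlt, hmul⟩ := mul_mem_subInt hβ hfin hp'.1 hp'.2.1 hp'.2.2.1.2.1 hp'.2.2.2
  let x' : K β := gen β * p.2 - (⌊β * (p.2 : ℝ)⌋ : ℤ)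
  have ex : (x' : ℝ) = betaMap β p.2 := by
    simp only [x']
    push_cast
    rw [coe_gen, betaMap, Int.fract]
  have hx' : x' ∈ tileIndex β :=
    ⟨sub_mem (mul_mem (gen_mem β) hp'.2.2.1.1) (intCast_mem _ _), by
      rw [ex]; exact Int.fract_nonneg _, by rw [ex]; exact Int.fract_lt_one _⟩
  refine ⟨(a, x'), (subtileIndex_iff hF).2 ⟨h1, h2, hx', by rwa [ex]⟩, fun hcl => hz ?_⟩
  have h3 := map_mem_closure (continuous_const_mul (phi β (gen β)⁻¹)) hcl
    (t := phi β '' (zInvNonneg β \ nodeSet β p)) ?_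
  · rwa [← mul_assoc, ← map_mul, inv_mul_cancel₀ (gen_ne_zero β), map_one, one_mul] at h3
  · rintro _ ⟨u, hu, rfl⟩
    refine ⟨(gen β)⁻¹ * u, ⟨⟨mul_mem (inv_gen_mem β) hu.1.1, ?_⟩, fun hmem => hu.2 ?_⟩,
      map_mul _ _ _⟩
    · push_cast
      rw [coe_gen]
      exact mul_nonneg (by positivity) hu.1.2
    · obtain ⟨z', hz', e⟩ := hmul _ hmem
      have : ((u - x' : K β) : ℝ) = z' := by
        push_cast at e ⊢
        rw [ex]
        rw [coe_gen, sub_add_cancel, mul_inv_cancel_left₀ (by linarith)] at e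
        linarith
      change ((u - x' : K β) : ℝ) ∈ subInt β a
      rwa [this]

omit hF in
lemma isClosed_exceptionalSet : IsClosed (exceptionalSet β) :=
  isClosed_biInter fun _ _ => isClosed_closure

lemma measure_exceptionalSet (μ : Measure (KBeta β)) [μ.IsAddHaarMeasure] :
    μ (exceptionalSet β) = 0 := by
  have hβ := hP.out.one_lt
  have hfin := hasFiniteExpansion_one hP.out hF
  let _ := fintypePrimesOver β
  let _ := fintypePlaces β
  let _ := normedCommRing β
  have := properSpace β
  have h0 : ((0 : K β) : ℝ) ∈ subInt β 1 := by
    simpa using zero_mem_subInt hβ hfin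
  -- The radius found at the β-integer `0` serves all centres `φ(x)` by translation; bounded integer
  -- parts make these centres relatively dense.
  obtain ⟨r, hr, hball⟩ := exists_ball_subInt hF h0 1
  obtain ⟨C, hC0, hC⟩ := exists_decomposition_K hF
  refine measure_eq_zero_of_porous μ (b := Units.map (phi β).toMonoidHom
    (Units.mk0 (gen β) (gen_ne_zero β))) (norm_phi_gen_lt_one β) isClosed_exceptionalSet
    (fun z => mul_gen_notMem_exceptionalSet hF) (X := phi β '' tileIndex β) hr ?_ (C := 1 + C) ?_
  · rintro _ ⟨x, hx, rfl⟩
    rw [Set.disjoint_left]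
    intro z hz hzN
    have hI : (1, x) ∈ subtileIndex β :=
      (subtileIndex_iff hF).2 ⟨le_rfl, expLength_pos hβ hfin, hx, hx.2.2⟩
    obtain ⟨_, hw, u, hu, rfl⟩ := mem_closure_iff.1 (Set.mem_iInter₂.1 hzN _ hI) _
      Metric.isOpen_ball hz
    refine hu.2 (hball (u - x) (sub_mem hu.1.1 hx.1) ?_ ?_)
    · push_cast
      linarith [hu.1.2, hx.2.2]
    · rwa [map_sub, map_zero, sub_zero, ← dist_eq_norm]
  · intro w
    obtain ⟨_, ⟨u, hu, rfl⟩, hd⟩ := (dense_phi_zInvNonneg β).exists_dist_lt w one_pos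
    obtain ⟨a, y, x, -, -, -, hx, rfl, -, -, hyC⟩ := hC u hu
    refine ⟨_, ⟨x, hx, rfl⟩, (dist_triangle _ (phi β (y + x)) _).trans
      (add_le_add hd.le ?_)⟩
    rw [dist_eq_norm, map_add, add_sub_cancel_right]
    exact hyC

/-! ### Boundaries of tiles and subtiles -/

variable (μ : Measure (KBeta β)) [μ.IsAddHaarMeasure]

/-- A boundary point lies in the closures of both `φ(fractSet β x)` and its complementary part of
`φ(D)`. The second handles the pieces inside the tile, the first all the others. -/
lemma measure_frontier_tile {x : K β} (hx : x ∈ tileIndex β) : μ (frontier (tile β x)) = 0 := by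
  refine measure_mono_null ((frontier_subset (dense_phi_zInvNonneg β) (fractSet β x)).trans ?_)
    (measure_exceptionalSet hF μ)
  rintro z ⟨hz, hz'⟩
  refine Set.mem_iInter₂.2 fun p hp => ?_
  by_cases hpx : p.2 = x
  · subst hpx
    exact closure_mono (Set.image_mono
      (Set.sdiff_subset_sdiff_right (nodeSet_subset_fractSet hF hp))) hz'
  · exact closure_subset_of_disjoint (fractSet_subset hF hx)
      ((fractSet_disjoint hpx).mono_left (nodeSet_subset_fractSet hF hp)) hz

lemma measure_frontier_nodeSet {p : ℕ × K β} (hp : p ∈ subtileIndex β) :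
    μ (frontier (subtileAt β p.1 p.2)) = 0 := by
  rw [subtileAt_eq]
  refine measure_mono_null ((frontier_subset (dense_phi_zInvNonneg β) _).trans ?_)
    (measure_exceptionalSet hF μ)
  rintro z ⟨hz, hz'⟩
  refine Set.mem_iInter₂.2 fun q hq => ?_
  by_cases hpq : q = p
  · subst hpq
    exact hz'
  · exact closure_subset_of_disjoint (nodeSet_subset hF hp.2.2.1)
      (nodeSet_disjoint hF hq hp hpq) hz

omit hF in
lemma frontier_subtileAt (a : ℕ) (x : K β) :
    frontier (subtileAt β a x) = (fun z => z - phi β x) ⁻¹' frontier (subtile β a) := by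
  have h := (Homeomorph.addRight (phi β x)).image_frontier (subtile β a)
  refine h.symm.trans ?_
  rw [Homeomorph.image_eq_preimage_symm]
  ext z
  simp only [Set.mem_preimage, sub_eq_add_neg]
  exact Iff.rfl

omit hF in
lemma measure_frontier_subtileAt_eq (a : ℕ) (x : K β) :
    μ (frontier (subtileAt β a x)) = μ (frontier (subtile β a)) := by
  rw [frontier_subtileAt]
  simp only [sub_eq_add_neg]
  exact measure_preimage_add_right μ _ _

lemma zero_mem_subtileIndex {a : ℕ} (h1 : 1 ≤ a) (h2 : a ≤ nodeCount β) :
    ((a, 0) : ℕ × K β) ∈ subtileIndex β := by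
  have h0 : ((0 : K β) : ℝ) = 0 := rfl
  refine (subtileIndex_iff hF).2 ⟨h1, (nodeCount_eq' hF) ▸ h2, ⟨zero_mem (zInvK β), ?_, ?_⟩, ?_⟩
  · exact h0.ge
  · exact h0.trans_lt one_pos
  · exact h0.trans_lt (quasiOrbit_mem _).1

/-- For arbitrary `x` the pair `(a, x)` need not be an index of the decomposition; translation
invariance reduces to `(a, 0)`, which always is. -/
lemma measure_frontier_subtileAt {a : ℕ} (h1 : 1 ≤ a) (h2 : a ≤ nodeCount β) (x : K β) :
    μ (frontier (subtileAt β a x)) = 0 := by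
  have h := measure_frontier_nodeSet hF μ (zero_mem_subtileIndex hF h1 h2)
  dsimp only at h
  rw [measure_frontier_subtileAt_eq] at h ⊢
  exact h

end Tiles

end BetaTile

end

/-! ### The tiling theorem -/

open BetaTile in
theorem mainTheorem3 (β : ℝ) [Fact (IsPisot β)] (hF : FinitenessProperty β)
    (μ : Measure (KBeta β)) [μ.IsAddHaarMeasure] :
    -- the complete `x`-tiles
    ((∀ x ∈ tileIndex β,
        tile β x = closure (interior (tile β x)) ∧
        (∀ z ∈ interior (tile β x), IsExclusive (tileIndex β) (tile β) x z) ∧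
        μ (frontier (tile β x)) = 0) ∧
      (∀ x ∈ tileIndex β, ∀ x' ∈ tileIndex β, x ≠ x' →
        Disjoint (tile β x') (interior (tile β x)) ∧
        μ (tile β x ∩ tile β x') = 0)) ∧
    -- for each node `a`, the translates of the complete central `a`-subtile
    (∀ a : ℕ, 1 ≤ a → a ≤ nodeCount β →
      (∀ x ∈ tileIndex β,
        subtileAt β a x = closure (interior (subtileAt β a x)) ∧
        (∀ z ∈ interior (subtileAt β a x), IsExclusive (tileIndex β) (subtileAt β a) x z) ∧
        μ (frontier (subtileAt β a x)) = 0) ∧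
      (∀ x ∈ tileIndex β, ∀ x' ∈ tileIndex β, x ≠ x' →
        Disjoint (subtileAt β a x') (interior (subtileAt β a x)) ∧
        μ (subtileAt β a x ∩ subtileAt β a x') = 0)) ∧
    -- the family of all translated subtiles, of all nodes, into which the `x`-tiles decompose
    ((∀ p ∈ subtileIndex β, ∀ z ∈ interior (subtileAt β p.1 p.2),
        IsExclusive (subtileIndex β) (fun q => subtileAt β q.1 q.2) p z) ∧
      (∀ p ∈ subtileIndex β, ∀ q ∈ subtileIndex β, p ≠ q →
        Disjoint (subtileAt β q.1 q.2) (interior (subtileAt β p.1 p.2)) ∧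
        μ (subtileAt β p.1 p.2 ∩ subtileAt β q.1 q.2) = 0)) := by
  have hD := dense_phi_zInvNonneg β
  have hclosed : ∀ a x, IsClosed (subtileAt β a x) := fun a x => by
    rw [subtileAt_eq]
    exact isClosed_closure
  refine ⟨?_, fun a h1 h2 => ?_, ?_⟩
  · have key := family_of_disjoint_interior (I := tileIndex β) (T := tile β)
      (fun _ _ => isClosed_closure)
      (fun x hx x' hx' hne => disjoint_interior (fractSet_subset hF hx)
        (notMem_closure_fractSet hF hx') (fractSet_disjoint hne))
      (fun x hx => measure_frontier_tile hF μ hx)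
    exact ⟨fun x hx => ⟨eq_closure_interior hD (notMem_closure_fractSet hF hx), key.1 x hx,
      measure_frontier_tile hF μ hx⟩, key.2⟩
  · have key := family_of_disjoint_interior (I := tileIndex β) (T := subtileAt β a)
      (fun x _ => hclosed a x)
      (fun x hx x' hx' hne => by
        rw [subtileAt_eq, subtileAt_eq]
        exact disjoint_interior (nodeSet_subset hF hx) (notMem_closure_nodeSet hF hx')
          (nodeSet_disjoint_of_same_node hF hx hx' hne))
      (fun x _ => measure_frontier_subtileAt hF μ h1 h2 x)
    refine ⟨fun x hx => ⟨?_, key.1 x hx, measure_frontier_subtileAt hF μ h1 h2 x⟩, key.2⟩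
    rw [subtileAt_eq]
    exact eq_closure_interior hD (notMem_closure_nodeSet hF hx)
  · exact family_of_disjoint_interior (I := subtileIndex β) (T := fun q => subtileAt β q.1 q.2)
      (fun p _ => hclosed p.1 p.2)
      (fun p hp q hq hne => by
        simp only [subtileAt_eq]
        exact disjoint_interior (nodeSet_subset hF hp.2.2.1)
          (notMem_closure_nodeSet hF hq.2.2.1) (nodeSet_disjoint hF hp hq hne))
      (fun p hp => measure_frontier_nodeSet hF μ hp)
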